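/- Let $M,L,N\ge 1$ be integers, put $c=\frac{ML}{N}$, and let $R$ be an $M\times M$ Hermitian positive definite complex matrix. Let $\mathbb{C}^+=\{z\in\mathbb{C}:\mathrm{Im}\,z>0\}$. For $z\in\mathbb{C}^+$, let $t(z)$ be the unique solution of $$t(z)=\frac1M\mathrm{Tr}\Big(R\,T(z)\Big),\qquad T(z)=\Big(-zI_M-\frac{z\,c\,t(z)}{1-z\,c^2\,t(z)^2}R\Big)^{-1},$$ such that $t(z)\in\mathbb{C}^+$ and $z\,t(z)\in\mathbb{C}^+$, and let $\nu$ be the unique finite positive measure carried by $[0,\infty)$ with Stieltjes transform $$\int\frac{d\nu(\lambda)}{\lambda-z}=\frac1M\mathrm{Tr}\,T(z),\qquad z\in\mathbb{C}^+ .$$ Assume $c\le 1$. Then $t(z)$ and $\nu$ are well defined, $\nu$ is a probability measure, and it is absolutely continuous with respect to the Lebesgue measure, with a density $g$ that is continuous on $(0,\infty)$ (and vanishes on $(-\infty,0)$). Moreover $g(x)\to+\infty$ as $x\to0^+$, and more precisely, as $x\to 0^+$: - if $c<1$, then $\displaystyle g(x)\sim\frac1\pi\,\frac{1}{\sqrt{c(1-c)}}\,\frac1M\mathrm{Tr}(R^{-1})\,\frac{1}{\sqrt{x}}$;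 - if $c=1$, then $\displaystyle g(x)\sim\frac{\sqrt3}{2\pi}\Big(\frac1M\mathrm{Tr}(R^{-1})\Big)^{2/3}\frac{1}{x^{2/3}}$. Here $u(x)\sim v(x)$ means $u(x)/v(x)\to1$. -/

import Mathlib

open MeasureTheory Filter Topology Set
open scoped ComplexOrder

noncomputable section

/-- The matrix `T = (-z I - (z c t / (1 - z c² t²)) R)⁻¹` attached to complex numbers `z` and `t`. -/
def resolventMatrix {M : ℕ} (c : ℝ) (R : Matrix (Fin M) (Fin M) ℂ) (z t : ℂ) :
    Matrix (Fin M) (Fin M) ℂ :=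
  (-(z • (1 : Matrix (Fin M) (Fin M) ℂ)) - ((z * c * t) / (1 - z * c ^ 2 * t ^ 2)) • R)⁻¹

/-- `t` solves the canonical equation `t = (1/M) Tr (R T)` at the point `z`,
with both `t` and `z t` in the open upper half-plane. -/
structure IsCanonicalSolution {M : ℕ} (c : ℝ) (R : Matrix (Fin M) (Fin M) ℂ) (z t : ℂ) :
    Prop where
  im_pos : 0 < t.im
  mul_im_pos : 0 < (z * t).im
  eq : t = (1 / (M : ℂ)) * (R * resolventMatrix c R z t).trace

/-- The function `t(z)`: the solution of the canonical equation at `z`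
(for `z` in the open upper half-plane). -/
def canonicalT {M : ℕ} (c : ℝ) (R : Matrix (Fin M) (Fin M) ℂ) (z : ℂ) : ℂ :=
  Classical.epsilon (IsCanonicalSolution c R z)

/-- The matrix-valued function `T(z)`. -/
def matrixT {M : ℕ} (c : ℝ) (R : Matrix (Fin M) (Fin M) ℂ) (z : ℂ) :
    Matrix (Fin M) (Fin M) ℂ :=
  resolventMatrix c R z (canonicalT c R z)

/-- `ν` is a finite positive measure carried by `[0, ∞)` whose Stieltjes transform on the open
upper half-plane is `z ↦ (1/M) Tr T(z)`. -/
structure HasCanonicalStieltjes {M : ℕ} (c : ℝ) (R : Matrix (Fin M) (Fin M) ℂ)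
    (ν : Measure ℝ) : Prop where
  finite : IsFiniteMeasure ν
  carried : ν (Iio 0) = 0
  stieltjes : ∀ z : ℂ, 0 < z.im →
    ∫ x : ℝ, ((x : ℂ) - z)⁻¹ ∂ν = (1 / (M : ℂ)) * (matrixT c R z).trace

/-- The deterministic equivalent: the measure with Stieltjes transform `(1/M) Tr T(z)`. -/
def deterministicEquivalent {M : ℕ} (c : ℝ) (R : Matrix (Fin M) (Fin M) ℂ) : Measure ℝ :=
  Classical.epsilon (HasCanonicalStieltjes c R)

/-- `g` is a nonnegative density on `(0, ∞)` of `ν` with respect to Lebesgue measure, continuous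
on `(0, ∞)`. Its values on `(0, ∞)` are determined by `ν`. -/
structure IsContinuousDensity (ν : Measure ℝ) (g : ℝ → ℝ) : Prop where
  continuousOn : ContinuousOn g (Ioi 0)
  nonneg : ∀ x ∈ Ioi (0 : ℝ), 0 ≤ g x
  eq_withDensity : ν = (volume.restrict (Ioi 0)).withDensity (fun x => ENNReal.ofReal (g x))

/-- The real number `(1/M) Tr R⁻¹` (the trace is real when `R` is Hermitian). -/
def normalizedTraceInv {M : ℕ} (R : Matrix (Fin M) (Fin M) ℂ) : ℝ :=
  (1 / (M : ℝ)) * (R⁻¹).trace.re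

end

/-! After diagonalising `R`, only its eigenvalues `rᵢ` matter. Let `κ` be the coefficient of `R` in
`T⁻¹`, up to sign, and put `p = -z / κ`. Then `T` has eigenvalues `p / (z (rᵢ - p))`, the canonical
equation reads `z t = q` with `q = qSum r p`, and the definition of `κ` becomes `z = phi p = -c q (p
- c q)`. Solving the canonical equation therefore means inverting an explicit rational map on `dom`.

Bijectivity. Taking imaginary parts gives a positive 2×2 linear system satisfied by `Im q` and `Im
t`, up to one strict inequality; positivity of these numbers forces the bound `contraction`. By
Cauchy–Schwarz the bound passes to divided differences of `phi`, so `phi` is injective with nonzero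
derivative on `dom`. Since `phi` tends to infinity at its poles and at infinity, its image is both
open and relatively closed in the upper half-plane, hence is all of it (`image_dom`).

The measure. Fibres of `phi` are finite, so the inverse `p(z)` extends continuously to the real line
(`exists_tendsto_pInv`), with `p(0) = 0` and `p(∞) = ∞`. Hence `m = (k(p) - 1) / z` is continuous
away from the origin, is `O(|z|^(-2/3))`, and is real on the negative axis. A Cauchy formula
(`integral_im_eq`) identifies `m` as the Stieltjes transform of the density `Im m(x) / π` on the
positive axis; `-iy m(iy) → 1` gives total mass one, and `eq_of_stieltjes_eq` gives uniqueness.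

Asymptotics. One has `m = p G(p) / z` with `G = gSum` and `G(0)` the mean of the `1 / rᵢ`. Near the
origin `phi p ~ -c (1 - c) p²` if `c < 1`, while for `c = 1` the double zero becomes triple and `phi
p ~ G(0) p³`. So `p ~ i √(x / (c (1 - c)))`, respectively `p ~ e^(2πi/3) (x / G(0))^(1/3)`; the
branch is selected by `Im p ≥ 0` and, in the cubic case, also by `Re p ≤ 0`. -/

noncomputable section

/-! ### The rational map `phi`: algebraic identities and injectivity on `dom`. -/

namespace Canonical

variable {M : ℕ} {r : Fin M → ℝ} {c : ℝ} {p z : ℂ}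

/-- `k(p) = (1/M) ∑ rᵢ / (rᵢ - p)`. -/
def kSum (r : Fin M → ℝ) (p : ℂ) : ℂ := (M : ℂ)⁻¹ * ∑ i, (r i : ℂ) / (r i - p)

/-- `G(p) = (1/M) ∑ 1 / (rᵢ - p)`. -/
def gSum (r : Fin M → ℝ) (p : ℂ) : ℂ := (M : ℂ)⁻¹ * ∑ i, 1 / ((r i : ℂ) - p)

/-- `q(p) = (1/M) ∑ rᵢ p / (rᵢ - p)`. -/
def qSum (r : Fin M → ℝ) (p : ℂ) : ℂ := (M : ℂ)⁻¹ * ∑ i, (r i : ℂ) * p / (r i - p)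

/-- `(1/M) ∑ rᵢ² / |rᵢ - p|²`. -/
def kappa (r : Fin M → ℝ) (p : ℂ) : ℝ :=
  (M : ℝ)⁻¹ * ∑ i, (r i) ^ 2 / Complex.normSq (r i - p)

/-- `(1/M) ∑ rᵢ² / ((rᵢ - p) (rᵢ - p'))`. -/
def kappa₂ (r : Fin M → ℝ) (p p' : ℂ) : ℂ :=
  (M : ℂ)⁻¹ * ∑ i, (r i : ℂ) ^ 2 / ((r i - p) * (r i - p'))

/-- The rational map inverting the canonical equation. -/
def phi (c : ℝ) (r : Fin M → ℝ) (p : ℂ) : ℂ := -c * qSum r p * (p - c * qSum r p)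

/-- The domain on which `phi` is a bijection onto the upper half-plane. -/
def dom (c : ℝ) (r : Fin M → ℝ) : Set ℂ :=
  {p | 0 < p.im ∧ 0 < (phi c r p).im ∧ 0 < (-phi c r p / p).im}

lemma qSum_eq (r : Fin M → ℝ) (p : ℂ) : qSum r p = p * kSum r p := by
  simp only [qSum, kSum, Finset.mul_sum]
  exact Finset.sum_congr rfl fun i _ => by ring

lemma kSum_eq (hM : 0 < M) (hp : ∀ i, (r i : ℂ) ≠ p) : kSum r p = 1 + p * gSum r p := by
  have hM' : (M : ℂ) ≠ 0 := by exact_mod_cast hM.ne'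
  have : ∀ i, (r i : ℂ) / (r i - p) = 1 + p * (1 / ((r i : ℂ) - p)) := fun i => by
    have := sub_ne_zero.2 (hp i)
    field_simp
    ring
  simp only [kSum, gSum, this, Finset.sum_add_distrib, ← Finset.mul_sum]
  simp
  field_simp

lemma phi_eq (c : ℝ) (r : Fin M → ℝ) (p : ℂ) :
    phi c r p = -c * p ^ 2 * kSum r p * (1 - c * kSum r p) := by
  rw [phi, qSum_eq]; ring

lemma ofReal_ne_of_im_pos (hp : 0 < p.im) (x : ℝ) : (x : ℂ) ≠ p := by
  rintro rfl; simp at hp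

lemma ne_zero_of_im_pos (hp : 0 < p.im) : p ≠ 0 := by
  rintro rfl; simp at hp

lemma im_avg (f : Fin M → ℂ) : ((M : ℂ)⁻¹ * ∑ i, f i).im = (M : ℝ)⁻¹ * ∑ i, (f i).im := by
  have : ((M : ℂ)⁻¹) = (((M : ℝ)⁻¹ : ℝ) : ℂ) := by push_cast; rfl
  rw [this, Complex.im_ofReal_mul, Complex.im_sum]

lemma re_avg (f : Fin M → ℂ) : ((M : ℂ)⁻¹ * ∑ i, f i).re = (M : ℝ)⁻¹ * ∑ i, (f i).re := by
  have : ((M : ℂ)⁻¹) = (((M : ℝ)⁻¹ : ℝ) : ℂ) := by push_cast; rfl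
  rw [this, Complex.re_ofReal_mul, Complex.re_sum]

lemma im_qSum (r : Fin M → ℝ) (p : ℂ) : (qSum r p).im = kappa r p * p.im := by
  have h : ∀ i, ((r i : ℂ) * p / (r i - p)).im
      = (r i) ^ 2 / Complex.normSq (r i - p) * p.im := fun i => by
    simp only [Complex.div_im]
    simp
    ring
  rw [qSum, kappa, im_avg, mul_assoc, Finset.sum_mul]
  simp only [h]

lemma kappa_nonneg (r : Fin M → ℝ) (p : ℂ) : 0 ≤ kappa r p := by
  unfold kappa
  have : ∀ i, 0 ≤ (r i) ^ 2 / Complex.normSq (r i - p) := fun i =>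
    div_nonneg (sq_nonneg _) (Complex.normSq_nonneg _)
  exact mul_nonneg (by positivity) (Finset.sum_nonneg fun i _ => this i)

lemma kappa_pos (hM : 0 < M) (hr : ∀ i, 0 < r i) (hp : ∀ i, (r i : ℂ) ≠ p) : 0 < kappa r p := by
  unfold kappa
  have : ∀ i, 0 < (r i) ^ 2 / Complex.normSq (r i - p) := fun i =>
    div_pos (pow_pos (hr i) 2) (Complex.normSq_pos.2 (sub_ne_zero.2 (hp i)))
  have hne : Nonempty (Fin M) := ⟨⟨0, hM⟩⟩
  exact mul_pos (by positivity) (Finset.sum_pos (fun i _ => this i) Finset.univ_nonempty)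

/-- Relations between `p`, `q` and `t = q / z` when `phi p = z`. -/
lemma qSum_ne_zero (hz : z ≠ 0) (h : phi c r p = z) : qSum r p ≠ 0 := by
  intro h0; apply hz; rw [← h, phi, h0]; simp

/-- With `t = q / z` this is `p = c q - 1 / (c t)`: both terms have positive imaginary part when `q`
and `t` do. -/
lemma eq_sub_inv (hc : c ≠ 0) (hz : z ≠ 0) (h : phi c r p = z) :
    p = c * qSum r p - (c * (qSum r p / z))⁻¹ := by
  have hq := qSum_ne_zero hz h
  have hc' : (c : ℂ) ≠ 0 := by exact_mod_cast hc
  have h' := h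
  rw [phi] at h'
  field_simp
  rw [← h']; ring

/-- Here `-z / p` plays the role of the coefficient `κ` of `R`, and the identity is `1 / κ = 1 / (c
z t) - c t`, the definition of `κ` inverted. -/
lemma inv_neg_div (hc : c ≠ 0) (hz : z ≠ 0) (h : phi c r p = z) :
    (-z / p)⁻¹ = (c * qSum r p)⁻¹ - c * (qSum r p / z) := by
  have hq := qSum_ne_zero hz h
  have hc' : (c : ℂ) ≠ 0 := by exact_mod_cast hc
  have h' := h
  rw [phi] at h'
  rw [inv_div]
  field_simp
  rw [← h']; ring

/-- The right side is `(1/M) Tr (R T)` in an eigenbasis of `R`, so this is the canonical equation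
with `t = q / z`. -/
lemma qSum_div_eq (hp : ∀ i, (r i : ℂ) ≠ p) (hp0 : p ≠ 0) (hz : z ≠ 0) :
    qSum r p / z = (M : ℂ)⁻¹ * ∑ i, (r i : ℂ) / (-z - (-z / p) * r i) := by
  rw [qSum, mul_div_assoc, Finset.sum_div]
  congr 1
  refine Finset.sum_congr rfl fun i _ => ?_
  have h1 := sub_ne_zero.2 (hp i)
  have : -z - (-z / p) * r i = z * (r i - p) / p := by field_simp; ring
  rw [this]; field_simp

lemma div_sub_eq (hp0 : p ≠ 0) (x : ℝ) : -z - (-z / p) * x = z * (x - p) / p := by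
  field_simp; ring

/-- Imaginary part of `t = q / z`, with `v = -z / p`. -/
lemma im_term (x : ℝ) (z v : ℂ) :
    ((x : ℂ) / (-z - v * x)).im = x * (z.im + x * v.im) / Complex.normSq (-z - v * x) := by
  rw [Complex.div_im]
  simp
  ring

lemma im_qSum_div (hp : ∀ i, (r i : ℂ) ≠ p) (hp0 : p ≠ 0) (hz : z ≠ 0) :
    (qSum r p / z).im = (M : ℝ)⁻¹ * ∑ i,
      r i * (z.im + r i * (-z / p).im) / Complex.normSq (-z - (-z / p) * r i) := by
  rw [qSum_div_eq hp hp0 hz, im_avg]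
  simp only [im_term]

lemma im_qSum_div_pos (hM : 0 < M) (hr : ∀ i, 0 < r i) (hp : ∀ i, (r i : ℂ) ≠ p) (hp0 : p ≠ 0)
    (hz : 0 < z.im) (hv : 0 ≤ (-z / p).im) : 0 < (qSum r p / z).im := by
  have hz0 := ne_zero_of_im_pos hz
  rw [im_qSum_div hp hp0 hz0]
  have hne : Nonempty (Fin M) := ⟨⟨0, hM⟩⟩
  refine mul_pos (by positivity) (Finset.sum_pos (fun i _ => ?_) Finset.univ_nonempty)
  have h := hr i
  refine div_pos (mul_pos h (by positivity)) (Complex.normSq_pos.2 ?_)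
  rw [div_sub_eq hp0]
  exact div_ne_zero (mul_ne_zero hz0 (sub_ne_zero.2 (hp i))) hp0

/-- In the exact formula for `Im t`, the summands carrying `Im z` are positive and are dropped; this
is the only source of strictness in `contraction`. -/
lemma im_qSum_div_gt (hM : 0 < M) (hr : ∀ i, 0 < r i) (hp : ∀ i, (r i : ℂ) ≠ p) (hp0 : p ≠ 0)
    (hz : 0 < z.im) :
    kappa r p * (Complex.normSq p / Complex.normSq z) * (-z / p).im < (qSum r p / z).im := by
  have hz0 := ne_zero_of_im_pos hz
  rw [im_qSum_div hp hp0 hz0, kappa, mul_assoc, mul_assoc]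
  have hne : Nonempty (Fin M) := ⟨⟨0, hM⟩⟩
  refine mul_lt_mul_of_pos_left ?_ (by positivity)
  rw [Finset.sum_mul]
  refine Finset.sum_lt_sum_of_nonempty Finset.univ_nonempty fun i _ => ?_
  have h := hr i
  rw [div_sub_eq hp0, Complex.normSq_div, Complex.normSq_mul]
  have h1 := Complex.normSq_pos.2 (sub_ne_zero.2 (hp i))
  have h2 := Complex.normSq_pos.2 hp0
  have h3 := Complex.normSq_pos.2 hz0
  have h4 : 0 < r i * z.im / (Complex.normSq z * Complex.normSq (r i - p) / Complex.normSq p) := by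
    positivity
  calc _ = r i * (r i * (-z / p).im) /
        (Complex.normSq z * Complex.normSq (r i - p) / Complex.normSq p) := by
        field_simp
    _ < _ := by
        rw [mul_add, add_div]
        linarith

lemma im_inv_neg (w : ℂ) : (-w⁻¹).im = w.im / Complex.normSq w := by
  simp [Complex.inv_im, neg_div]

/-- `Im p` in terms of `Im q` and `Im t`. -/
lemma im_eq (hc : c ≠ 0) (hz : z ≠ 0) (h : phi c r p = z) :
    p.im = c * (qSum r p).im +
      Complex.normSq z / (c * Complex.normSq (qSum r p)) * (qSum r p / z).im := by
  have hq := qSum_ne_zero hz h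
  have h1 := congrArg Complex.im (eq_sub_inv hc hz h)
  rw [sub_eq_add_neg, Complex.add_im, im_inv_neg, Complex.im_ofReal_mul, Complex.im_ofReal_mul,
    Complex.normSq_mul, Complex.normSq_ofReal, Complex.normSq_div] at h1
  rw [h1]
  have := (Complex.normSq_pos.2 hq).ne'
  have := (Complex.normSq_pos.2 hz).ne'
  field_simp

/-- `Im (-z / p)` in terms of `Im q` and `Im t`. -/
lemma im_neg_div (hc : c ≠ 0) (hz : z ≠ 0) (hp0 : p ≠ 0) (h : phi c r p = z) :
    (-z / p).im = Complex.normSq z / Complex.normSq p *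
      (c * (qSum r p / z).im + (qSum r p).im / (c * Complex.normSq (qSum r p))) := by
  have hq := qSum_ne_zero hz h
  have h1 := congrArg Complex.im (inv_neg_div hc hz h)
  have h2 : ((c * qSum r p)⁻¹).im = - ((qSum r p).im / (c * Complex.normSq (qSum r p))) := by
    rw [Complex.inv_im, Complex.normSq_mul, Complex.normSq_ofReal, Complex.im_ofReal_mul]
    field_simp
  rw [Complex.sub_im, h2, Complex.im_ofReal_mul, Complex.inv_im, Complex.normSq_div,
    Complex.normSq_neg] at h1
  have h3 := (Complex.normSq_pos.2 hp0)
  have h4 := (Complex.normSq_pos.2 hz)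
  have h5 : (-z / p).im = Complex.normSq z / Complex.normSq p *
     (- (-(-z / p).im / (Complex.normSq z / Complex.normSq p))) := by
    field_simp
  rw [h5, h1]
  ring

/-- A solution of `phi p = z` with `t` in the upper half-plane and `q` in its closure lies in
the domain. -/
lemma mem_dom_of (hc : 0 < c) (hz : 0 < z.im) (h : phi c r p = z)
    (ht : 0 < (qSum r p / z).im) (hq : 0 ≤ (qSum r p).im) : p ∈ dom c r := by
  have hz0 := ne_zero_of_im_pos hz
  have hz1 := Complex.normSq_pos.2 hz0
  have hq1 := Complex.normSq_pos.2 (qSum_ne_zero hz0 h)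
  have hp : 0 < p.im := by
    rw [im_eq hc.ne' hz0 h]
    have : 0 < Complex.normSq z / (c * Complex.normSq (qSum r p)) * (qSum r p / z).im := by
      positivity
    nlinarith
  have hp1 := Complex.normSq_pos.2 (ne_zero_of_im_pos hp)
  refine ⟨hp, h.symm ▸ hz, ?_⟩
  rw [h, im_neg_div hc.ne' hz0 (ne_zero_of_im_pos hp) h]
  positivity

/-- A Perron–Frobenius argument. With `Y' = Y / w`, the hypotheses say that the symmetric positive
matrix with diagonal entries `K c` and off-diagonal entries `K w / (c a)` maps the positive vector
`(X, Y')` to a vector no larger, one coordinate being strictly smaller. Its largest eigenvalue `K (c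
+ w / (c a))` is then below one. -/
lemma contraction_real {K c w a X Y : ℝ} (hK : 0 < K) (hc : 0 < c) (hw : 0 < w) (ha : 0 < a)
    (hX : 0 < X) (hY : 0 < Y) (h1 : Y = K * (c * Y + w ^ 2 / (c * a) * X))
    (h2 : K * (c * X + Y / (c * a)) < X) : K * (c + w / (c * a)) < 1 := by
  by_contra! hcon
  set e := K / (c * a) with he
  have hep : 0 < e := by positivity
  have h1' : (1 - K * c) * Y = e * w ^ 2 * X := by
    have : K * (w ^ 2 / (c * a) * X) = e * w ^ 2 * X := by rw [he]; field_simp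
    linarith
  have h2' : e * Y < (1 - K * c) * X := by
    have : K * (Y / (c * a)) = e * Y := by rw [he]; field_simp
    linarith
  have h3 : 1 - K * c ≤ e * w := by
    have : K * (w / (c * a)) = e * w := by rw [he]; field_simp
    linarith
  have h4 : 0 < 1 - K * c := by
    by_contra! h
    nlinarith [mul_pos hep hY]
  have h5 : e * ((1 - K * c) * Y) < (1 - K * c) ^ 2 * X := by nlinarith
  rw [h1'] at h5
  have h6 : (1 - K * c) ^ 2 * X ≤ (e * w) ^ 2 * X := by gcongr
  nlinarith

/-- `contraction_real` applied to `X = Im t`, `Y = Im q`, `w = |z|`, `a = |q|²`. The equation comes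
from `Im q = kappa * Im p`, the inequality from `im_qSum_div_gt`. -/
lemma contraction (hM : 0 < M) (hr : ∀ i, 0 < r i) (hc : 0 < c) (hp : p ∈ dom c r) :
    kappa r p * (c + ‖phi c r p‖ / (c * ‖qSum r p‖ ^ 2)) < 1 := by
  obtain ⟨h1, h2, h3⟩ := hp
  have hp0 := ne_zero_of_im_pos h1
  have hpi : ∀ i, (r i : ℂ) ≠ p := fun i => ofReal_ne_of_im_pos h1 _
  obtain ⟨z, hz⟩ : ∃ z, phi c r p = z := ⟨_, rfl⟩
  rw [hz] at h2 h3 ⊢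
  have hz0 := ne_zero_of_im_pos h2
  have hK := kappa_pos hM hr hpi
  have hq0 := qSum_ne_zero hz0 hz
  have hX := im_qSum_div_pos hM hr hpi hp0 h2 h3.le
  have hY : 0 < (qSum r p).im := by rw [im_qSum]; positivity
  refine contraction_real hK hc (norm_pos_iff.2 hz0) (by positivity) hX hY ?_ ?_
  · rw [← Complex.normSq_eq_norm_sq, ← Complex.normSq_eq_norm_sq, ← im_eq hc.ne' hz0 hz, im_qSum]
  · have := im_qSum_div_gt hM hr hpi hp0 h2
    rw [im_neg_div hc.ne' hz0 hp0 hz] at this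
    rw [← Complex.normSq_eq_norm_sq]
    have h4 := Complex.normSq_pos.2 hp0
    have h5 := Complex.normSq_pos.2 hz0
    refine lt_of_eq_of_lt ?_ this
    field_simp

lemma norm_kappa₂_sq_le (r : Fin M → ℝ) (p p' : ℂ) :
    ‖kappa₂ r p p'‖ ^ 2 ≤ kappa r p * kappa r p' := by
  have h1 : ‖kappa₂ r p p'‖ ≤ (M : ℝ)⁻¹ * ∑ i, (|r i| / ‖r i - p‖) * (|r i| / ‖r i - p'‖) := by
    rw [kappa₂, norm_mul]
    refine mul_le_mul (by simp) ?_ (norm_nonneg _) (by positivity)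
    · refine (norm_sum_le _ _).trans (le_of_eq (Finset.sum_congr rfl fun i _ => ?_))
      rw [norm_div, norm_mul, norm_pow, Complex.norm_real, Real.norm_eq_abs]
      ring
  have h2 := Finset.sum_mul_sq_le_sq_mul_sq Finset.univ (fun i => |r i| / ‖(r i : ℂ) - p‖)
    (fun i => |r i| / ‖(r i : ℂ) - p'‖)
  calc ‖kappa₂ r p p'‖ ^ 2 ≤ ((M : ℝ)⁻¹ * ∑ i, (|r i| / ‖r i - p‖) * (|r i| / ‖r i - p'‖)) ^ 2 := by
        gcongr
    _ ≤ _ := by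
        rw [mul_pow]
        refine (mul_le_mul_of_nonneg_left h2 (by positivity)).trans (le_of_eq ?_)
        simp only [kappa, div_pow, sq_abs, Complex.normSq_eq_norm_sq]
        ring

/-- The divided difference of `phi`. -/
def phiSlope (c : ℝ) (r : Fin M → ℝ) (p p' : ℂ) : ℂ :=
  -c * qSum r p' + c * kappa₂ r p p' * (c * (qSum r p + qSum r p') - p)

lemma qSum_sub (hp : ∀ i, (r i : ℂ) ≠ p) {p' : ℂ} (hp' : ∀ i, (r i : ℂ) ≠ p') :
    qSum r p - qSum r p' = (p - p') * kappa₂ r p p' := by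
  rw [qSum, qSum, kappa₂, ← mul_sub, ← Finset.sum_sub_distrib, mul_left_comm (p - p'),
    Finset.mul_sum (a := p - p')]
  congr 1
  refine Finset.sum_congr rfl fun i _ => ?_
  have h1 := sub_ne_zero.2 (hp i)
  have h2 := sub_ne_zero.2 (hp' i)
  field_simp
  ring

lemma phi_sub (hp : ∀ i, (r i : ℂ) ≠ p) {p' : ℂ} (hp' : ∀ i, (r i : ℂ) ≠ p') :
    phi c r p - phi c r p' = (p - p') * phiSlope c r p p' := by
  have h := qSum_sub hp hp'
  rw [phi, phi, phiSlope]
  linear_combination (c * (c * (qSum r p + qSum r p') - p)) * h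

/-- On a common fibre the slope factors as `c q' (-1 + κ₂ (c + z / (c q q')))`. Cauchy–Schwarz, for
`κ₂` and again for the bracket, bounds the product by the geometric mean of the two quantities in
`contraction`, so it cannot equal one. The diagonal case is the nonvanishing of the derivative. -/
lemma phiSlope_ne_zero (hM : 0 < M) (hr : ∀ i, 0 < r i) (hc : 0 < c) (hp : p ∈ dom c r) {p' : ℂ}
    (hp' : p' ∈ dom c r) (h : phi c r p = phi c r p') : phiSlope c r p p' ≠ 0 := by
  have hA := contraction hM hr hc hp
  have hB := contraction hM hr hc hp'
  have hz0 := ne_zero_of_im_pos hp.2.1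
  obtain ⟨z, hz⟩ : ∃ z, phi c r p = z := ⟨_, rfl⟩
  rw [← h] at hB
  rw [hz] at hA hB hz0
  have hq := qSum_ne_zero hz0 hz
  have hq' := qSum_ne_zero hz0 (h.symm.trans hz)
  have hc' : (c : ℂ) ≠ 0 := by exact_mod_cast hc.ne'
  have hE := eq_sub_inv hc.ne' hz0 hz
  have hS : phiSlope c r p p' = c * qSum r p' *
      (-1 + kappa₂ r p p' * (c + z / (c * (qSum r p * qSum r p')))) := by
    have : c * (qSum r p + qSum r p') - p
        = qSum r p' * (c + z / (c * (qSum r p * qSum r p'))) := by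
      nth_rw 2 [hE]
      field_simp
      ring
    rw [phiSlope, this]; ring
  rw [hS]
  refine mul_ne_zero (mul_ne_zero hc' hq') fun h0 => ?_
  have h1 : kappa₂ r p p' * (c + z / (c * (qSum r p * qSum r p'))) = 1 := by
    linear_combination h0
  have h2 : ‖kappa₂ r p p'‖ * (c + ‖z‖ / (c * (‖qSum r p‖ * ‖qSum r p'‖))) ≥ 1 := by
    calc (1 : ℝ) = ‖kappa₂ r p p' * (c + z / (c * (qSum r p * qSum r p')))‖ := by rw [h1]; simp
      _ ≤ _ := by
        rw [norm_mul]
        gcongr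
        refine (norm_add_le _ _).trans (le_of_eq ?_)
        simp [abs_of_pos hc]
  have h3 := norm_kappa₂_sq_le r p p'
  have hn := norm_pos_iff.2 hq
  have hn' := norm_pos_iff.2 hq'
  have hzn := norm_pos_iff.2 hz0
  set a := ‖qSum r p‖
  set b := ‖qSum r p'‖
  set n := ‖z‖
  have h4 : (c + n / (c * (a * b))) ^ 2 ≤ (c + n / (c * a ^ 2)) * (c + n / (c * b ^ 2)) := by
    have : (c + n / (c * a ^ 2)) * (c + n / (c * b ^ 2)) - (c + n / (c * (a * b))) ^ 2
        = n * (1 / a - 1 / b) ^ 2 := by field_simp; ring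
    nlinarith [mul_nonneg hzn.le (sq_nonneg (1 / a - 1 / b))]
  have hkn := kappa_nonneg r p
  have hkn' := kappa_nonneg r p'
  have h5 : (‖kappa₂ r p p'‖ * (c + n / (c * (a * b)))) ^ 2 < 1 := by
    rw [mul_pow]
    calc _ ≤ (kappa r p * kappa r p') * ((c + n / (c * a ^ 2)) * (c + n / (c * b ^ 2))) := by
          gcongr
      _ = (kappa r p * (c + n / (c * a ^ 2))) * (kappa r p' * (c + n / (c * b ^ 2))) := by ring
      _ < 1 := mul_lt_one_of_nonneg_of_lt_one_left (by positivity) hA hB.le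
  nlinarith

lemma dom_ne (hp : p ∈ dom c r) (i : Fin M) : (r i : ℂ) ≠ p := ofReal_ne_of_im_pos hp.1 _

lemma phi_injOn (hM : 0 < M) (hr : ∀ i, 0 < r i) (hc : 0 < c) : InjOn (phi c r) (dom c r) := by
  intro p hp p' hp' h
  have h1 := phi_sub (c := c) (dom_ne hp) (dom_ne hp')
  rw [h, sub_self, eq_comm, mul_eq_zero] at h1
  exact sub_eq_zero.1 (h1.resolve_right (phiSlope_ne_zero hM hr hc hp hp' h))

lemma hasStrictDerivAt_qSum (hp : ∀ i, (r i : ℂ) ≠ p) :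
    HasStrictDerivAt (qSum r) (kappa₂ r p p) p := by
  unfold qSum kappa₂
  refine HasStrictDerivAt.const_mul _ ?_
  refine HasStrictDerivAt.fun_sum fun i _ => ?_
  have h1 := sub_ne_zero.2 (hp i)
  have := (((hasStrictDerivAt_id p).const_mul (r i : ℂ)).div
    ((hasStrictDerivAt_id p).const_sub (r i : ℂ)) h1)
  refine this.congr_deriv ?_
  simp only [id]
  field_simp
  ring

lemma hasStrictDerivAt_phi (hp : ∀ i, (r i : ℂ) ≠ p) :
    HasStrictDerivAt (phi c r) (phiSlope c r p p) p := by
  have h := hasStrictDerivAt_qSum hp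
  have := (h.const_mul (-c : ℂ)).mul ((hasStrictDerivAt_id p).sub (h.const_mul (c : ℂ)))
  refine this.congr_deriv ?_
  simp only [id, phiSlope, Pi.sub_apply]
  ring

lemma continuousAt_phi (hp : ∀ i, (r i : ℂ) ≠ p) : ContinuousAt (phi c r) p :=
  (hasStrictDerivAt_phi hp).hasDerivAt.continuousAt

lemma isOpen_dom (c : ℝ) (r : Fin M → ℝ) : IsOpen (dom c r) := by
  rw [isOpen_iff_mem_nhds]
  intro p hp
  have h1 : ContinuousAt (phi c r) p := continuousAt_phi (dom_ne hp)
  have h2 : ContinuousAt (fun p => -phi c r p / p) p :=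
    h1.neg.div continuousAt_id (ne_zero_of_im_pos hp.1)
  have a := (Complex.continuous_im.continuousAt (x := p)).eventually (lt_mem_nhds hp.1)
  have b := (Complex.continuous_im.continuousAt.comp h1).eventually (lt_mem_nhds hp.2.1)
  have d := (Complex.continuous_im.continuousAt.comp h2).eventually (lt_mem_nhds hp.2.2)
  filter_upwards [a, b, d] with x hx hy hw using ⟨hx, hy, hw⟩

lemma isOpen_image (hM : 0 < M) (hr : ∀ i, 0 < r i) (hc : 0 < c) :
    IsOpen (phi c r '' dom c r) := by
  rw [isOpen_iff_mem_nhds]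
  rintro _ ⟨p, hp, rfl⟩
  have := (hasStrictDerivAt_phi (c := c) (dom_ne hp)).map_nhds_eq
    (phiSlope_ne_zero hM hr hc hp hp rfl)
  rw [← this]
  exact image_mem_map ((isOpen_dom c r).mem_nhds hp)

end Canonical

end

/-! ### Properness of `phi` and surjectivity onto the upper half-plane. -/

noncomputable section

namespace Canonical

variable {M : ℕ} {r : Fin M → ℝ} {c : ℝ} {p z : ℂ}

open Bornology

lemma Tendsto.mul_cobounded {α : Type*} {l : Filter α} {f g : α → ℂ}
    (hf : Tendsto f l (cobounded ℂ)) (hg : Tendsto g l (cobounded ℂ)) :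
    Tendsto (fun x => f x * g x) l (cobounded ℂ) := by
  rw [← tendsto_norm_atTop_iff_cobounded] at *
  simp only [norm_mul]
  exact hf.atTop_mul_atTop₀ hg

lemma Tendsto.cobounded_mul {α : Type*} {l : Filter α} {f g : α → ℂ} {a : ℂ}
    (hf : Tendsto f l (cobounded ℂ)) (hg : Tendsto g l (𝓝 a)) (ha : a ≠ 0) :
    Tendsto (fun x => f x * g x) l (cobounded ℂ) := by
  rw [← tendsto_norm_atTop_iff_cobounded] at *
  simp only [norm_mul]
  exact hf.atTop_mul_pos (norm_pos_iff.2 ha) hg.norm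

lemma Tendsto.cobounded_add {α : Type*} {l : Filter α} {f g : α → ℂ} {a : ℂ}
    (hf : Tendsto f l (cobounded ℂ)) (hg : Tendsto g l (𝓝 a)) :
    Tendsto (fun x => f x + g x) l (cobounded ℂ) := by
  rw [← tendsto_norm_atTop_iff_cobounded] at *
  refine tendsto_atTop_mono (fun x => ?_) (hf.atTop_add hg.norm.neg)
  have := norm_sub_norm_le (f x) (-g x)
  rw [norm_neg, sub_neg_eq_add] at this
  linarith

lemma tendsto_qSum_pole (hM : 0 < M) (hr : ∀ i, 0 < r i) (j : Fin M) :
    Tendsto (qSum r) (𝓝[≠] (r j : ℂ)) (cobounded ℂ) := by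
  -- Minus the residue at `r j`. Repeated eigenvalues contribute terms of the same sign, so they
  -- cannot cancel.
  set A : ℂ := (M : ℂ)⁻¹ * ∑ i, if r i = r j then (r i : ℂ) * r j else 0 with hA
  have hA0 : A ≠ 0 := by
    have : A = (((M : ℝ)⁻¹ * ∑ i, if r i = r j then r i * r j else 0 : ℝ) : ℂ) := by
      rw [hA]; push_cast [apply_ite (fun x : ℝ => (x : ℂ))]; rfl
    rw [this, Complex.ofReal_ne_zero]
    refine (mul_pos (by positivity) ?_).ne'
    refine Finset.sum_pos' (fun i _ => ?_) ⟨j, Finset.mem_univ _, ?_⟩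
    · have := hr i
      have := hr j
      split_ifs <;> positivity
    · have := hr j
      simp only [if_true]; positivity
  have h1 : Tendsto (fun p : ℂ => ((r j : ℂ) - p)⁻¹) (𝓝[≠] (r j : ℂ)) (cobounded ℂ) := by
    refine Filter.tendsto_inv₀_nhdsNE_zero.comp (tendsto_nhdsWithin_iff.2 ⟨?_, ?_⟩)
    · have : ContinuousAt (fun p : ℂ => (r j : ℂ) - p) (r j) := by fun_prop
      simpa using this.tendsto.mono_left nhdsWithin_le_nhds
    · filter_upwards [self_mem_nhdsWithin] with p hp
      exact sub_ne_zero.2 (Ne.symm hp)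
  have h2 : Tendsto (fun p : ℂ => (M : ℂ)⁻¹ * ∑ i, (r i : ℂ) * p / (r i - p) * (r j - p))
      (𝓝[≠] (r j : ℂ)) (𝓝 A) := by
    refine Tendsto.const_mul _ (tendsto_finsetSum _ fun i _ => ?_)
    split_ifs with h
    · have : Tendsto (fun p : ℂ => (r i : ℂ) * p) (𝓝[≠] (r j : ℂ)) (𝓝 ((r i : ℂ) * r j)) :=
        ((continuous_const.mul continuous_id).tendsto _).mono_left nhdsWithin_le_nhds
      refine this.congr' ?_
      filter_upwards [self_mem_nhdsWithin] with p hp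
      have := sub_ne_zero.2 (Ne.symm hp)
      rw [h]; field_simp
    · have hne : (r i : ℂ) - r j ≠ 0 := sub_ne_zero.2 (by exact_mod_cast h)
      have : ContinuousAt (fun p : ℂ => (r i : ℂ) * p / (r i - p) * (r j - p)) (r j) := by
        fun_prop (disch := exact hne)
      simpa using this.tendsto.mono_left nhdsWithin_le_nhds
  refine (Tendsto.cobounded_mul h1 h2 hA0).congr' ?_
  filter_upwards [self_mem_nhdsWithin] with p hp
  have := sub_ne_zero.2 (Ne.symm hp)
  rw [qSum, ← Finset.sum_mul]; field_simp

lemma tendsto_phi_pole (hM : 0 < M) (hr : ∀ i, 0 < r i) (hc : c ≠ 0) (j : Fin M) :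
    Tendsto (phi c r) (𝓝[≠] (r j : ℂ)) (cobounded ℂ) := by
  have hq := tendsto_qSum_pole hM hr j
  have hc' : (-c : ℂ) ≠ 0 := by simpa using hc
  have h1 : Tendsto (fun p => qSum r p * (-c : ℂ)) (𝓝[≠] (r j : ℂ)) (cobounded ℂ) :=
    Tendsto.cobounded_mul hq tendsto_const_nhds hc'
  have h2 := Tendsto.cobounded_add h1 (g := fun p => p) (tendsto_id.mono_left nhdsWithin_le_nhds)
  refine (Tendsto.mul_cobounded h1 h2).congr fun p => ?_
  rw [phi]; ring

lemma tendsto_inv_sub_cobounded (x : ℂ) :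
    Tendsto (fun p : ℂ => (x - p)⁻¹) (cobounded ℂ) (𝓝 0) := by
  refine Filter.tendsto_inv₀_cobounded.comp ?_
  have h1 : Tendsto (fun p : ℂ => p * (-1)) (cobounded ℂ) (cobounded ℂ) :=
    Tendsto.cobounded_mul tendsto_id tendsto_const_nhds (by norm_num)
  refine (Tendsto.cobounded_add h1 (tendsto_const_nhds (x := x))).congr fun p => by ring

lemma tendsto_kSum_cobounded (r : Fin M → ℝ) : Tendsto (kSum r) (cobounded ℂ) (𝓝 0) := by
  have : Tendsto (fun p : ℂ => (M : ℂ)⁻¹ * ∑ i, (r i : ℂ) * (r i - p)⁻¹) (cobounded ℂ)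
      (𝓝 ((M : ℂ)⁻¹ * ∑ i : Fin M, (r i : ℂ) * 0)) :=
    Tendsto.const_mul _ (tendsto_finsetSum _ fun i _ => (tendsto_inv_sub_cobounded _).const_mul _)
  simp only [mul_zero, Finset.sum_const_zero] at this
  exact this.congr fun p => by simp only [kSum, div_eq_mul_inv]

lemma tendsto_qSum_cobounded (r : Fin M → ℝ) :
    Tendsto (qSum r) (cobounded ℂ) (𝓝 ((M : ℂ)⁻¹ * ∑ i, (-r i : ℂ))) := by
  refine Tendsto.const_mul _ (tendsto_finsetSum _ fun i _ => ?_)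
  have h1 := ((tendsto_inv_sub_cobounded (r i : ℂ)).const_mul ((r i : ℂ) ^ 2)).const_add (-r i : ℂ)
  rw [mul_zero, add_zero] at h1
  refine h1.congr' ?_
  filter_upwards [eventually_ne_cobounded (r i : ℂ)] with p hp
  have := sub_ne_zero.2 hp.symm
  field_simp; ring

lemma avg_neg_ne_zero (hM : 0 < M) (hr : ∀ i, 0 < r i) : (M : ℂ)⁻¹ * ∑ i, (-r i : ℂ) ≠ 0 := by
  have hne : Nonempty (Fin M) := ⟨⟨0, hM⟩⟩
  refine mul_ne_zero (by simpa using hM.ne') ?_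
  have := (Finset.sum_pos (fun i _ => hr i) Finset.univ_nonempty).ne'
  rw [Finset.sum_neg_distrib, neg_ne_zero]
  exact_mod_cast this

/-- `qSum` has a nonzero finite limit at infinity, so `phi` grows linearly there. -/
lemma tendsto_phi_cobounded (hM : 0 < M) (hr : ∀ i, 0 < r i) (hc : c ≠ 0) :
    Tendsto (phi c r) (cobounded ℂ) (cobounded ℂ) := by
  have hq := tendsto_qSum_cobounded r
  have h1 := Tendsto.cobounded_add tendsto_id (hq.const_mul (-c : ℂ))
  refine (Tendsto.cobounded_mul h1 (hq.const_mul (-c : ℂ)) (mul_ne_zero (by simpa using hc)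
    (avg_neg_ne_zero hM hr))).congr fun p => ?_
  rw [phi, id]; ring

/-- `phi` is proper on the upper half-plane. -/
lemma exists_le_nhds (hM : 0 < M) (hr : ∀ i, 0 < r i) (hc : c ≠ 0) (F : Ultrafilter ℂ)
    (hF : {p : ℂ | 0 < p.im} ∈ F) (h : Tendsto (phi c r) F (𝓝 z)) :
    ∃ p, (F : Filter ℂ) ≤ 𝓝 p ∧ (∀ i, (r i : ℂ) ≠ p) ∧ phi c r p = z ∧ 0 ≤ p.im := by
  have key : ∀ l : Filter ℂ, (F : Filter ℂ) ≤ l → Tendsto (phi c r) l (cobounded ℂ) → False := by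
    intro l hl h'
    have h1 := h'.mono_left hl
    have : Disjoint (𝓝 z) (cobounded ℂ) := Metric.disjoint_nhds_cobounded z
    exact (h.not_tendsto this) h1
  have hb : ∃ R : ℝ, Metric.closedBall (0 : ℂ) R ∈ F := by
    by_contra! hcon
    refine key (cobounded ℂ) ?_ (tendsto_phi_cobounded hM hr hc)
    rw [← comap_norm_atTop]
    rw [← map_le_iff_le_comap]
    refine Filter.tendsto_atTop.2 fun R => ?_
    have := Ultrafilter.compl_mem_iff_notMem.2 (hcon R)
    filter_upwards [this] with p hp
    simp at hp
    exact hp.le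
  obtain ⟨R, hR⟩ := hb
  obtain ⟨p, -, hp⟩ := (isCompact_closedBall (0 : ℂ) R).ultrafilter_le_nhds F (le_principal_iff.2 hR)
  have hpi : ∀ i, (r i : ℂ) ≠ p := by
    rintro i rfl
    refine key (𝓝[≠] (r i : ℂ)) (le_inf hp (le_principal_iff.2 ?_)) (tendsto_phi_pole hM hr hc i)
    filter_upwards [hF] with p hp
    exact (ofReal_ne_of_im_pos hp _).symm
  refine ⟨p, hp, hpi, ?_, ?_⟩
  · exact tendsto_nhds_unique ((continuousAt_phi hpi).tendsto.mono_left hp) h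
  · refine ge_of_tendsto ((Complex.continuous_im.tendsto p).mono_left hp) ?_
    filter_upwards [hF] with p hp using le_of_lt hp

lemma phi_zero (c : ℝ) (r : Fin M → ℝ) : phi c r 0 = 0 := by simp [phi, qSum]

/-- Limits of points of `dom` satisfy only weak inequalities, but `Im z > 0` with `Im (-z / p) ≥ 0`
already forces `Im t > 0`, and `mem_dom_of` then restores all the strict ones. -/
lemma closure_image_inter (hM : 0 < M) (hr : ∀ i, 0 < r i) (hc : 0 < c) :
    closure (phi c r '' dom c r) ∩ {z : ℂ | 0 < z.im} ⊆ phi c r '' dom c r := by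
  rintro z ⟨hz, hzi : 0 < z.im⟩
  have hne := mem_closure_iff_nhdsWithin_neBot.1 hz
  have hne' : (comap (phi c r) (𝓝[phi c r '' dom c r] z) ⊓ 𝓟 (dom c r)).NeBot :=
    comap_inf_principal_neBot_of_image_mem hne self_mem_nhdsWithin
  set F := Ultrafilter.of (comap (phi c r) (𝓝[phi c r '' dom c r] z) ⊓ 𝓟 (dom c r))
  have hF : (F : Filter ℂ) ≤ comap (phi c r) (𝓝[phi c r '' dom c r] z) ⊓ 𝓟 (dom c r) :=
    Ultrafilter.of_le _
  have hD : dom c r ∈ F := hF (mem_inf_of_right (mem_principal_self _))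
  have hT : Tendsto (phi c r) F (𝓝 z) :=
    (map_le_iff_le_comap.2 (hF.trans inf_le_left)).trans nhdsWithin_le_nhds
  obtain ⟨p, hp, hpi, hpz, him⟩ := exists_le_nhds hM hr hc.ne' F
    (mem_of_superset hD fun p hp => hp.1) hT
  have hp0 : p ≠ 0 := by
    rintro rfl
    rw [phi_zero] at hpz
    simp [← hpz] at hzi
  refine ⟨p, mem_dom_of hc hzi hpz (im_qSum_div_pos hM hr hpi hp0 hzi ?_) ?_, hpz⟩
  · have h2 : ContinuousAt (fun p => -phi c r p / p) p :=
      (continuousAt_phi hpi).neg.div continuousAt_id hp0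
    rw [← hpz]
    refine ge_of_tendsto ((Complex.continuous_im.continuousAt.comp h2).tendsto.mono_left hp) ?_
    filter_upwards [hD] with p hp using hp.2.2.le
  · rw [im_qSum]
    exact mul_nonneg (kappa_nonneg _ _) him

lemma dom_nonempty (hM : 0 < M) (hr : ∀ i, 0 < r i) (hc : 0 < c) (hc1 : c ≤ 1) :
    (dom c r).Nonempty := by
  have hne : Nonempty (Fin M) := ⟨⟨0, hM⟩⟩
  -- The witness is `p = i Y` with `Y` above every `rᵢ`, which makes `Re k < 1/2`. Up to positive
  -- factors the two conditions on `phi` are the positivity of `Im (k (1 - c k))` and of `Re (k (1 -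
  -- c k))`, and both follow from `c Re k < 1/2`.
  set Y : ℝ := 1 + ∑ i, r i with hYd
  have hrY : ∀ i, r i < Y := fun i => by
    have := Finset.single_le_sum (f := r) (fun i _ => (hr i).le) (Finset.mem_univ i)
    linarith
  have hY : 0 < Y := (hr ⟨0, hM⟩).trans (hrY _)
  set p : ℂ := Complex.I * Y with hpd
  have hpim : p.im = Y := by simp [hpd]
  have hp0 : p ≠ 0 := ne_zero_of_im_pos (hpim ▸ hY)
  have hn : ∀ i, Complex.normSq (r i - p) = r i ^ 2 + Y ^ 2 := fun i => by
    simp [Complex.normSq_apply, hpd]; ring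
  have ha : (kSum r p).re = (M : ℝ)⁻¹ * ∑ i, r i ^ 2 / (r i ^ 2 + Y ^ 2) := by
    rw [kSum, re_avg]
    congr 1
    refine Finset.sum_congr rfl fun i _ => ?_
    rw [Complex.div_re, hn]
    simp [hpd]; ring
  have hb : (kSum r p).im = (M : ℝ)⁻¹ * ∑ i, r i * Y / (r i ^ 2 + Y ^ 2) := by
    rw [kSum, im_avg]
    congr 1
    refine Finset.sum_congr rfl fun i _ => ?_
    rw [Complex.div_im, hn]
    simp [hpd]; ring
  have hM' : (0 : ℝ) < (M : ℝ)⁻¹ := by positivity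
  have ha0 : 0 < (kSum r p).re := by
    rw [ha]
    refine mul_pos hM' (Finset.sum_pos (fun i _ => ?_) Finset.univ_nonempty)
    have := hr i
    positivity
  have hb0 : 0 < (kSum r p).im := by
    rw [hb]
    refine mul_pos hM' (Finset.sum_pos (fun i _ => ?_) Finset.univ_nonempty)
    have := hr i
    positivity
  have ha1 : (kSum r p).re < 1 / 2 := by
    rw [ha]
    calc _ < (M : ℝ)⁻¹ * ∑ i : Fin M, (1 / 2 : ℝ) := by
          refine mul_lt_mul_of_pos_left (Finset.sum_lt_sum_of_nonempty Finset.univ_nonempty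
            fun i _ => ?_) hM'
          have h1 := hr i
          have h2 := hrY i
          rw [div_lt_div_iff₀ (by positivity) (by positivity)]
          nlinarith
      _ = 1 / 2 := by simp; field_simp
  have h1 : phi c r p = ((c * Y ^ 2 : ℝ) : ℂ) * (kSum r p * (1 - c * kSum r p)) := by
    rw [phi_eq, hpd, mul_pow, Complex.I_sq]; push_cast; ring
  have h2 : -phi c r p / p = ((c * Y : ℝ) : ℂ) * (Complex.I * (kSum r p * (1 - c * kSum r p))) := by
    rw [phi_eq, div_eq_iff hp0, hpd]
    push_cast
    ring
  refine ⟨p, hpim ▸ hY, ?_, ?_⟩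
  · rw [h1, Complex.im_ofReal_mul]
    refine mul_pos (by positivity) ?_
    simp only [Complex.mul_im, Complex.sub_re, Complex.sub_im, Complex.one_re, Complex.one_im,
      Complex.mul_re, Complex.ofReal_re, Complex.ofReal_im]
    have hca : c * (kSum r p).re < 1 / 2 := by nlinarith
    have := mul_pos hb0 (sub_pos.2 hca)
    linarith
  · rw [h2, Complex.im_ofReal_mul]
    refine mul_pos (by positivity) ?_
    simp only [Complex.mul_im, Complex.mul_re, Complex.I_re, Complex.I_im,
      Complex.sub_re, Complex.sub_im, Complex.one_re, Complex.one_im,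
      Complex.ofReal_re, Complex.ofReal_im]
    have hca : c * (kSum r p).re < 1 / 2 := by nlinarith
    have h3 := mul_pos ha0 (sub_pos.2 hca)
    have h4 := mul_pos hc (mul_pos hb0 hb0)
    linarith

lemma image_dom (hM : 0 < M) (hr : ∀ i, 0 < r i) (hc : 0 < c) (hc1 : c ≤ 1) :
    {z : ℂ | 0 < z.im} ⊆ phi c r '' dom c r := by
  refine IsPreconnected.subset_of_closure_inter_subset ?_ (isOpen_image hM hr hc) ?_
    (closure_image_inter hM hr hc)
  · exact (convex_halfSpace_im_gt 0).isPreconnected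
  · obtain ⟨p, hp⟩ := dom_nonempty hM hr hc hc1
    exact ⟨phi c r p, hp.2.1, mem_image_of_mem _ hp⟩

/-- The inverse of `phi` on the upper half-plane. -/
def pInv (c : ℝ) (r : Fin M → ℝ) (z : ℂ) : ℂ := Function.invFunOn (phi c r) (dom c r) z

lemma pInv_mem (hM : 0 < M) (hr : ∀ i, 0 < r i) (hc : 0 < c) (hc1 : c ≤ 1) (hz : 0 < z.im) :
    pInv c r z ∈ dom c r := Function.invFunOn_mem (image_dom hM hr hc hc1 hz)

lemma phi_pInv (hM : 0 < M) (hr : ∀ i, 0 < r i) (hc : 0 < c) (hc1 : c ≤ 1) (hz : 0 < z.im) :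
    phi c r (pInv c r z) = z := Function.invFunOn_eq (image_dom hM hr hc hc1 hz)

lemma pInv_eq (hM : 0 < M) (hr : ∀ i, 0 < r i) (hc : 0 < c) (hc1 : c ≤ 1) (hp : p ∈ dom c r) :
    pInv c r (phi c r p) = p :=
  phi_injOn hM hr hc (pInv_mem hM hr hc hc1 hp.2.1) hp (phi_pInv hM hr hc hc1 hp.2.1)

/-- The local inverse supplied by the inverse function theorem stays in `dom`, so by injectivity it
coincides with `pInv` nearby. -/
lemma differentiableAt_pInv (hM : 0 < M) (hr : ∀ i, 0 < r i) (hc : 0 < c) (hc1 : c ≤ 1)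
    (hz : 0 < z.im) : DifferentiableAt ℂ (pInv c r) z := by
  have hp := pInv_mem hM hr hc hc1 hz
  have hpz := phi_pInv hM hr hc hc1 hz
  have hd := hasStrictDerivAt_phi (c := c) (dom_ne hp)
  have hd0 := phiSlope_ne_zero hM hr hc hp hp rfl
  have h1 := hd.to_localInverse hd0
  have h2 : ∀ᶠ w in 𝓝 (phi c r (pInv c r z)), hd.localInverse _ _ _ hd0 w ∈ dom c r := by
    refine h1.hasDerivAt.continuousAt.eventually_mem ?_
    have : hd.localInverse _ _ _ hd0 (phi c r (pInv c r z)) = pInv c r z :=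
      (hd.eventually_left_inverse hd0).self_of_nhds
    rw [this]
    exact (isOpen_dom c r).mem_nhds hp
  have h3 : pInv c r =ᶠ[𝓝 (phi c r (pInv c r z))] hd.localInverse _ _ _ hd0 := by
    filter_upwards [h2, hd.eventually_right_inverse hd0] with w hw hw'
    rw [← pInv_eq hM hr hc hc1 hw, hw']
  have h4 := (h1.hasDerivAt.congr_of_eventuallyEq h3).differentiableAt
  rwa [hpz] at h4

end Canonical

end

/-! ### Boundary values of the inverse map, and its limits at zero and infinity. -/

noncomputable section

namespace Canonical

variable {M : ℕ} {r : Fin M → ℝ} {c : ℝ} {p z : ℂ}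

open Bornology

/-- The open upper half-plane. -/
abbrev uhp : Set ℂ := {z : ℂ | 0 < z.im}

/-- If the cluster values of a continuous function on the upper half-plane at a boundary point
form a finite set, then the function converges there. -/
lemma tendsto_of_finite_cluster {f : ℂ → ℂ} {x : ℝ} {K : Set ℂ} (hK : K.Finite)
    (hf : ContinuousOn f uhp)
    (H : ∀ F : Ultrafilter ℂ, (F : Filter ℂ) ≤ 𝓝[uhp] (x : ℂ) → ∃ k ∈ K, Tendsto f F (𝓝 k))
    {F₀ : Ultrafilter ℂ} (hF₀ : (F₀ : Filter ℂ) ≤ 𝓝[uhp] (x : ℂ)) {k : ℂ}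
    (hk : Tendsto f F₀ (𝓝 k)) : Tendsto f (𝓝[uhp] (x : ℂ)) (𝓝 k) := by
  have hcl : IsClosed (K \ {k}) := (hK.subset sdiff_subset).isClosed
  -- The radius `d` isolates `k` from the rest of `K`. Values near the boundary point lie either
  -- close to `k` or outside a slightly larger disc, and connectedness of a half-disc rules out
  -- jumping between the two.
  obtain ⟨d, hd, hball⟩ := Metric.isOpen_iff.1 hcl.isOpen_compl k (by simp)
  have hU : ∀ U : Set ℂ, IsOpen U → K ⊆ U → ∀ᶠ z in 𝓝[uhp] (x : ℂ), f z ∈ U := by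
    intro U hU hKU
    by_contra hcon
    have hne : (𝓝[uhp] (x : ℂ) ⊓ 𝓟 {z | f z ∉ U}).NeBot := by
      rw [← frequently_mem_iff_neBot]
      exact fun h => hcon (h.mono fun z hz => not_not.1 hz)
    obtain ⟨k', hk', ht⟩ := H (Ultrafilter.of (𝓝[uhp] (x : ℂ) ⊓ 𝓟 {z | f z ∉ U})) ((Ultrafilter.of_le _).trans inf_le_left)
    have h1 := ht.eventually (hU.mem_nhds (hKU hk'))
    have h2 : ∀ᶠ z in (Ultrafilter.of (𝓝[uhp] (x : ℂ) ⊓ 𝓟 {z | f z ∉ U}) : Filter ℂ), f z ∉ U :=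
      (Ultrafilter.of_le (𝓝[uhp] (x : ℂ) ⊓ 𝓟 {z | f z ∉ U})) (mem_inf_of_right (mem_principal_self _))
    obtain ⟨z, hz, hz'⟩ := (h1.and h2).exists
    exact hz' hz
  rw [Metric.tendsto_nhds]
  intro ε hε
  set e := min ε (d / 2) with he
  have hepos : 0 < e := lt_min hε (by linarith)
  have h1 := hU (Metric.ball k e ∪ (Metric.closedBall k e)ᶜ)
    (Metric.isOpen_ball.union Metric.isClosed_closedBall.isOpen_compl) (by
      intro y hy
      by_cases hyk : y = k
      · left; rw [hyk]; exact Metric.mem_ball_self hepos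
      · right
        intro hy'
        have : y ∈ Metric.ball k d := by
          have h2 : dist y k ≤ e := hy'
          have h3 : e ≤ d / 2 := min_le_right _ _
          exact Metric.mem_ball.2 (by linarith)
        exact hball this ⟨hy, hyk⟩)
  obtain ⟨ρ, hρ, hρs⟩ := Metric.mem_nhdsWithin_iff.1 h1
  have hpre : IsPreconnected (f '' (Metric.ball (x : ℂ) ρ ∩ uhp)) :=
    ((convex_ball _ _).inter (convex_halfSpace_im_gt 0)).isPreconnected.image _
      (hf.mono inter_subset_right)
  have hsub := hpre.subset_left_of_subset_union Metric.isOpen_ball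
    Metric.isClosed_closedBall.isOpen_compl
    (disjoint_compl_right.mono_left Metric.ball_subset_closedBall)
    (image_subset_iff.2 hρs) (by
      have h2 : Metric.ball (x : ℂ) ρ ∩ uhp ∈ F₀ :=
        hF₀ (inter_mem (mem_nhdsWithin_of_mem_nhds (Metric.ball_mem_nhds _ hρ)) self_mem_nhdsWithin)
      obtain ⟨z, hz, hz'⟩ := ((hk.eventually (Metric.ball_mem_nhds k hepos)).and h2).exists
      exact ⟨f z, mem_image_of_mem _ hz', hz⟩)
  refine mem_of_superset (inter_mem (mem_nhdsWithin_of_mem_nhds (Metric.ball_mem_nhds _ hρ))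
    self_mem_nhdsWithin) fun z hz => ?_
  exact (Metric.mem_ball.1 (hsub (mem_image_of_mem _ hz))).trans_le (min_le_left _ _)

/-- Fibres of `phi` are finite. -/
lemma finite_fiber (hM : 0 < M) (hr : ∀ i, 0 < r i) (hc : c ≠ 0) (x : ℂ) :
    {p : ℂ | (∀ i, (r i : ℂ) ≠ p) ∧ phi c r p = x}.Finite := by
  open Polynomial in
  set A : ℂ[X] := ∏ i, (C (r i : ℂ) - X) with hA
  set Q : ℂ[X] := C (M : ℂ)⁻¹ * ∑ i, C (r i : ℂ) * X * ∏ j ∈ Finset.univ.erase i,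
    (C (r j : ℂ) - X) with hQ
  -- The equation `phi p = x` with denominators cleared. The polynomial is nonzero because `phi` is
  -- unbounded at infinity.
  set B : ℂ[X] := C x * A ^ 2 + C (c : ℂ) * Q * (X * A - C (c : ℂ) * Q) with hB
  have hAe : ∀ p, A.eval p = ∏ i, ((r i : ℂ) - p) := fun p => by
    simp [hA, Polynomial.eval_prod]
  have hQe : ∀ p, (∀ i, (r i : ℂ) ≠ p) → Q.eval p = qSum r p * A.eval p := fun p hp => by
    rw [hAe, qSum, mul_assoc, Finset.sum_mul]
    simp only [hQ, Polynomial.eval_mul, Polynomial.eval_C, Polynomial.eval_finsetSum,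
      Polynomial.eval_X, Polynomial.eval_prod, Polynomial.eval_sub]
    congr 1
    refine Finset.sum_congr rfl fun i _ => ?_
    rw [← Finset.mul_prod_erase Finset.univ _ (Finset.mem_univ i)]
    have := sub_ne_zero.2 (hp i)
    field_simp
  have hBe : ∀ p, (∀ i, (r i : ℂ) ≠ p) → B.eval p = (x - phi c r p) * (A.eval p) ^ 2 :=
    fun p hp => by
      simp only [hB, Polynomial.eval_add, Polynomial.eval_mul, Polynomial.eval_C,
        Polynomial.eval_pow, Polynomial.eval_sub, Polynomial.eval_X, hQe p hp, phi]
      ring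
  have hB0 : B ≠ 0 := by
    intro h0
    have h1 : ∀ᶠ p in cobounded ℂ, ∀ i, (r i : ℂ) ≠ p := by
      rw [eventually_all]
      exact fun i => (eventually_ne_cobounded (r i : ℂ)).mono fun p hp => hp.symm
    have h2 := (tendsto_phi_cobounded hM hr hc).eventually (eventually_ne_cobounded x)
    obtain ⟨p, hp, hpx⟩ := (h1.and h2).exists
    have h3 := hBe p hp
    rw [h0, Polynomial.eval_zero, eq_comm, mul_eq_zero, hAe] at h3
    rcases h3 with h3 | h3
    · exact hpx (sub_eq_zero.1 h3).symm
    · have := pow_eq_zero_iff (two_ne_zero) |>.1 h3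
      obtain ⟨i, -, hi⟩ := Finset.prod_eq_zero_iff.1 this
      exact hp i (sub_eq_zero.1 hi)
  refine (Polynomial.finite_setOfPred_isRoot hB0).subset fun p hp => ?_
  rw [mem_ofPred_eq, Polynomial.IsRoot, hBe p hp.1, hp.2]
  simp

lemma continuousOn_pInv (hM : 0 < M) (hr : ∀ i, 0 < r i) (hc : 0 < c) (hc1 : c ≤ 1) :
    ContinuousOn (pInv c r) uhp := fun _ hz =>
  (differentiableAt_pInv hM hr hc hc1 hz).continuousAt.continuousWithinAt

/-- Cluster values of `pInv` at a point of the closed half-plane. -/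
lemma exists_tendsto_pInv_ultrafilter (hM : 0 < M) (hr : ∀ i, 0 < r i) (hc : 0 < c) (hc1 : c ≤ 1)
    (x : ℂ) (F : Ultrafilter ℂ) (hF : (F : Filter ℂ) ≤ 𝓝[uhp] x) :
    ∃ p ∈ {p : ℂ | (∀ i, (r i : ℂ) ≠ p) ∧ phi c r p = x}, Tendsto (pInv c r) F (𝓝 p) := by
  have hu : uhp ∈ F := hF self_mem_nhdsWithin
  obtain ⟨p, hp, hpi, hpx, -⟩ := exists_le_nhds (z := x) hM hr hc.ne' (F.map (pInv c r)) (by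
      rw [Ultrafilter.mem_map]
      exact mem_of_superset hu fun z hz => (pInv_mem hM hr hc hc1 hz).1) (by
      rw [Ultrafilter.coe_map, tendsto_map'_iff]
      refine (tendsto_id.mono_left (hF.trans nhdsWithin_le_nhds)).congr' ?_
      filter_upwards [hu] with z hz
      exact (phi_pInv hM hr hc hc1 hz).symm)
  exact ⟨p, ⟨hpi, hpx⟩, hp⟩

instance uhp_neBot (x : ℝ) : (𝓝[uhp] (x : ℂ)).NeBot := by
  rw [← mem_closure_iff_nhdsWithin_neBot, Complex.closure_setOfPred_lt_im]
  simp

/-- `pInv` has boundary values. -/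
lemma exists_tendsto_pInv (hM : 0 < M) (hr : ∀ i, 0 < r i) (hc : 0 < c) (hc1 : c ≤ 1)
    (x : ℝ) : ∃ p : ℂ, (∀ i, (r i : ℂ) ≠ p) ∧ phi c r p = x ∧
      Tendsto (pInv c r) (𝓝[uhp] (x : ℂ)) (𝓝 p) := by
  have H := exists_tendsto_pInv_ultrafilter hM hr hc hc1 (x : ℂ)
  obtain ⟨p, hp, hpt⟩ := H (Ultrafilter.of _) (Ultrafilter.of_le _)
  exact ⟨p, hp.1, hp.2, tendsto_of_finite_cluster (finite_fiber hM hr hc.ne' x)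
    (continuousOn_pInv hM hr hc hc1) H (Ultrafilter.of_le _) hpt⟩

/-- In the second quadrant, `pInv` has negative real part. -/
lemma re_pInv_neg (hM : 0 < M) (hr : ∀ i, 0 < r i) (hc : 0 < c) (hc1 : c ≤ 1) (hz : 0 < z.im)
    (hz' : z.re ≤ 0) : (pInv c r z).re < 0 := by
  have hp := pInv_mem hM hr hc hc1 hz
  have hpz := phi_pInv hM hr hc hc1 hz
  set p := pInv c r z
  have hz0 := ne_zero_of_im_pos hz
  have hp0 := ne_zero_of_im_pos hp.1
  have ht : 0 < (qSum r p / z).im :=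
    im_qSum_div_pos hM hr (dom_ne hp) hp0 hz (hpz ▸ hp.2.2).le
  have hq : 0 < (qSum r p).im := by
    rw [im_qSum]; exact mul_pos (kappa_pos hM hr (dom_ne hp)) hp.1
  have h := congrArg Complex.re (eq_sub_inv hc.ne' hz0 hpz)
  have hqz : qSum r p = z * (qSum r p / z) := by field_simp
  set t := qSum r p / z
  -- Since `q = z t`, with `Re z ≤ 0` and `Im t > 0`, positivity of `Im q` forces `Re t > 0`, hence
  -- `Re q < 0`; both terms of `p = c q - 1 / (c t)` then have negative real part.
  have h1 : (qSum r p).im = z.re * t.im + z.im * t.re := by rw [hqz, Complex.mul_im]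
  have h2 : (qSum r p).re = z.re * t.re - z.im * t.im := by rw [hqz, Complex.mul_re]
  have h3 : 0 < t.re := by
    by_contra! hcon
    nlinarith [mul_nonneg (neg_nonneg.2 hz') ht.le]
  have h4 : (qSum r p).re < 0 := by
    rw [h2]; nlinarith [mul_nonneg (neg_nonneg.2 hz') h3.le, mul_pos hz ht]
  have h5 : 0 < ((c * t)⁻¹).re := by
    rw [Complex.inv_re, Complex.re_ofReal_mul]
    refine div_pos (mul_pos hc h3) (Complex.normSq_pos.2 ?_)
    exact mul_ne_zero (by exact_mod_cast hc.ne') (ne_zero_of_im_pos ht)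
  rw [Complex.sub_re, Complex.re_ofReal_mul] at h
  nlinarith

/-- For nonzero `p` with `Re p ≤ 0` one has `|rᵢ - p| > rᵢ`, so `|k| < 1`, while `Re k > 0`. With `c
≤ 1` none of the factors `p²`, `k`, `1 - c k` of `phi` vanishes. -/
lemma eq_zero_of_phi_eq_zero (hM : 0 < M) (hr : ∀ i, 0 < r i) (hc : 0 < c) (hc1 : c ≤ 1)
    (hp : p.re ≤ 0) (h : phi c r p = 0) : p = 0 := by
  by_contra hp0
  have hne : Nonempty (Fin M) := ⟨⟨0, hM⟩⟩
  have hM' : (0 : ℝ) < (M : ℝ)⁻¹ := by positivity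
  have hpi : ∀ i, 0 < ((r i : ℂ) - p).re := fun i => by
    have := hr i
    simp; linarith
  have hpi' : ∀ i, (r i : ℂ) - p ≠ 0 := fun i h => by simpa [h] using hpi i
  have hk : 0 < (kSum r p).re := by
    rw [kSum, re_avg]
    refine mul_pos hM' (Finset.sum_pos (fun i _ => ?_) Finset.univ_nonempty)
    rw [Complex.div_re]
    have h1 := hr i
    have h2 := hpi i
    have h3 := Complex.normSq_pos.2 (hpi' i)
    rw [Complex.ofReal_re, Complex.ofReal_im, zero_mul, zero_div, add_zero]
    positivity
  have hk1 : ‖kSum r p‖ < 1 := by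
    have h1 : ‖kSum r p‖ ≤ (M : ℝ)⁻¹ * ∑ i, r i / ‖(r i : ℂ) - p‖ := by
      rw [kSum, norm_mul]
      refine mul_le_mul (by simp) ?_ (norm_nonneg _) hM'.le
      refine (norm_sum_le _ _).trans (le_of_eq (Finset.sum_congr rfl fun i _ => ?_))
      rw [norm_div, Complex.norm_real, Real.norm_eq_abs, abs_of_pos (hr i)]
    refine h1.trans_lt ?_
    calc _ < (M : ℝ)⁻¹ * ∑ i : Fin M, (1 : ℝ) := by
          refine mul_lt_mul_of_pos_left (Finset.sum_lt_sum_of_nonempty Finset.univ_nonempty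
            fun i _ => ?_) hM'
          have h3 := norm_pos_iff.2 (hpi' i)
          have h4 := hr i
          rw [div_lt_one h3]
          refine lt_of_pow_lt_pow_left₀ 2 h3.le ?_
          rw [← Complex.normSq_eq_norm_sq, Complex.normSq_apply]
          simp only [Complex.sub_re, Complex.sub_im, Complex.ofReal_re, Complex.ofReal_im]
          have h5 := Complex.normSq_pos.2 hp0
          rw [Complex.normSq_apply] at h5
          nlinarith
      _ = 1 := by simp; field_simp
  rw [phi_eq] at h
  have hc' : (c : ℂ) ≠ 0 := by exact_mod_cast hc.ne'
  have hk0 : kSum r p ≠ 0 := fun h0 => by simp [h0] at hk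
  have h6 : (1 - c * kSum r p) = 0 := by
    refine (mul_eq_zero.1 h).resolve_left ?_
    exact mul_ne_zero (mul_ne_zero (neg_ne_zero.2 hc') (pow_ne_zero 2 hp0)) hk0
  have h7 : ‖(c : ℂ) * kSum r p‖ = 1 := by rw [← sub_eq_zero.1 h6]; simp
  rw [norm_mul, Complex.norm_real, Real.norm_eq_abs, abs_of_pos hc] at h7
  nlinarith [norm_nonneg (kSum r p)]

lemma tendsto_mul_I : Tendsto (fun y : ℝ => (y : ℂ) * Complex.I) (𝓝[>] 0) (𝓝[uhp] 0) := by
  refine tendsto_nhdsWithin_iff.2 ⟨?_, ?_⟩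
  · have : Continuous (fun y : ℝ => (y : ℂ) * Complex.I) := by fun_prop
    simpa using (this.tendsto 0).mono_left nhdsWithin_le_nhds
  · filter_upwards [self_mem_nhdsWithin] with y hy
    simpa using hy

/-- `pInv z → 0` as `z → 0`. -/
lemma tendsto_pInv_zero (hM : 0 < M) (hr : ∀ i, 0 < r i) (hc : 0 < c) (hc1 : c ≤ 1) :
    Tendsto (pInv c r) (𝓝[uhp] 0) (𝓝 0) := by
  obtain ⟨p, hp, hpx, hpt⟩ := exists_tendsto_pInv hM hr hc hc1 0
  rw [Complex.ofReal_zero] at hpt hpx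
  suffices p = 0 by rwa [this] at hpt
  refine eq_zero_of_phi_eq_zero hM hr hc hc1 ?_ hpx
  refine le_of_tendsto ((Complex.continuous_re.tendsto p).comp (hpt.comp tendsto_mul_I)) ?_
  filter_upwards [self_mem_nhdsWithin] with y hy
  exact (re_pInv_neg hM hr hc hc1 (by simpa using hy) (by simp)).le

lemma tendsto_neg_inv_uhp : Tendsto (fun w : ℂ => -w⁻¹) (𝓝[uhp] 0) (cobounded ℂ ⊓ 𝓟 uhp) := by
  refine tendsto_inf.2 ⟨?_, tendsto_principal.2 ?_⟩
  · have h1 : Tendsto (fun w : ℂ => w⁻¹) (𝓝[uhp] 0) (cobounded ℂ) :=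
      Filter.tendsto_inv₀_nhdsNE_zero.mono_left (nhdsWithin_mono _ fun z hz => ne_zero_of_im_pos hz)
    rw [← tendsto_norm_atTop_iff_cobounded] at h1 ⊢
    simpa using h1
  · filter_upwards [self_mem_nhdsWithin] with w hw
    have : w ≠ 0 := ne_zero_of_im_pos hw
    rw [im_inv_neg]
    exact div_pos hw (Complex.normSq_pos.2 this)

lemma tendsto_neg_inv_uhp' : Tendsto (fun w : ℂ => -w⁻¹) (cobounded ℂ ⊓ 𝓟 uhp) (𝓝[uhp] 0) := by
  refine tendsto_nhdsWithin_iff.2 ⟨?_, ?_⟩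
  · simpa using (Filter.tendsto_inv₀_cobounded (α := ℂ)).neg.mono_left
      (inf_le_left (b := 𝓟 uhp))
  · filter_upwards [mem_inf_of_right (mem_principal_self _)] with w hw
    have hw' : 0 < w.im := hw
    have : w ≠ 0 := ne_zero_of_im_pos hw
    rw [im_inv_neg]
    exact div_pos hw (Complex.normSq_pos.2 this)

/-- Since `Im (-z / p) > 0`, the imaginary part of `z + (-z / p) rᵢ` is at least `Im z`. On the
imaginary axis this gives `|p| ≤ |rᵢ - p|`, which keeps `pInv` away from the poles. -/
lemma norm_sub_ge (hM : 0 < M) (hr : ∀ i, 0 < r i) (hc : 0 < c) (hc1 : c ≤ 1) (hz : 0 < z.im)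
    (i : Fin M) : z.im * ‖pInv c r z‖ ≤ ‖z‖ * ‖(r i : ℂ) - pInv c r z‖ := by
  have hp := pInv_mem hM hr hc hc1 hz
  have hpz := phi_pInv hM hr hc hc1 hz
  set p := pInv c r z
  have hp0 := ne_zero_of_im_pos hp.1
  have h1 := hp.2.2
  rw [hpz] at h1
  have h2 := div_sub_eq (z := z) hp0 (r i)
  have h3 : z.im ≤ ‖z * (r i - p) / p‖ := by
    rw [← h2]
    refine le_trans ?_ (Complex.abs_im_le_norm _)
    refine le_trans ?_ (neg_le_abs _)
    rw [Complex.sub_im, Complex.neg_im, Complex.im_mul_ofReal]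
    nlinarith [hr i]
  rwa [norm_div, norm_mul, le_div_iff₀ (norm_pos_iff.2 hp0)] at h3

/-- `pInv z → ∞` as `z → ∞`. -/
lemma tendsto_pInv_cobounded (hM : 0 < M) (hr : ∀ i, 0 < r i) (hc : 0 < c) (hc1 : c ≤ 1) :
    Tendsto (pInv c r) (cobounded ℂ ⊓ 𝓟 uhp) (cobounded ℂ) := by
  -- The change of variable `z = -1 / w` preserves the half-plane and moves infinity to the origin.
  -- As `phi p → ∞` there, `p` can only cluster at infinity or at a pole, so `1 / p` has finitely
  -- many cluster values.
  set f : ℂ → ℂ := fun w => (pInv c r (-w⁻¹))⁻¹ with hf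
  have hmaps : ∀ w ∈ uhp, -w⁻¹ ∈ uhp := fun w hw => by
    rw [mem_ofPred_eq, im_inv_neg]
    exact div_pos hw (Complex.normSq_pos.2 (ne_zero_of_im_pos hw))
  have hcont : ContinuousOn f uhp := by
    refine ContinuousOn.inv₀ ?_ fun w hw => ne_zero_of_im_pos (pInv_mem hM hr hc hc1 (hmaps w hw)).1
    refine (continuousOn_pInv hM hr hc hc1).comp ?_ hmaps
    exact (continuousOn_inv₀.mono fun w hw => ne_zero_of_im_pos hw).neg
  set K : Set ℂ := insert 0 (range fun i => (r i : ℂ)⁻¹) with hK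
  have H : ∀ F : Ultrafilter ℂ, (F : Filter ℂ) ≤ 𝓝[uhp] (0 : ℂ) → ∃ k ∈ K, Tendsto f F (𝓝 k) := by
    intro F hF
    have hu : uhp ∈ F := hF self_mem_nhdsWithin
    set G := F.map (fun w => pInv c r (-w⁻¹)) with hG
    have hφ : Tendsto (phi c r) G (cobounded ℂ) := by
      rw [hG, Ultrafilter.coe_map, tendsto_map'_iff]
      refine ((tendsto_neg_inv_uhp.mono_right inf_le_left).mono_left hF).congr' ?_
      filter_upwards [hu] with w hw
      exact (phi_pInv hM hr hc hc1 (hmaps w hw)).symm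
    by_cases hb : ∃ R : ℝ, Metric.closedBall (0 : ℂ) R ∈ G
    · obtain ⟨R, hR⟩ := hb
      obtain ⟨p, -, hp⟩ :=
        (isCompact_closedBall (0 : ℂ) R).ultrafilter_le_nhds G (le_principal_iff.2 hR)
      by_cases hpi : ∀ i, (r i : ℂ) ≠ p
      · exact absurd hφ (((continuousAt_phi hpi).tendsto.mono_left hp).not_tendsto
          (Metric.disjoint_nhds_cobounded _))
      · push Not at hpi
        obtain ⟨i, hi⟩ := hpi
        refine ⟨p⁻¹, Or.inr ⟨i, by simp only [hi]⟩, ?_⟩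
        have hp0 : p ≠ 0 := by rw [← hi]; exact_mod_cast (hr i).ne'
        exact Tendsto.inv₀ (f := fun w => pInv c r (-w⁻¹)) hp hp0
    · refine ⟨0, Or.inl rfl, ?_⟩
      push Not at hb
      have hGc : (G : Filter ℂ) ≤ cobounded ℂ := by
        rw [← comap_norm_atTop, ← map_le_iff_le_comap]
        refine Filter.tendsto_atTop.2 fun R => ?_
        filter_upwards [Ultrafilter.compl_mem_iff_notMem.2 (hb R)] with p hp
        simp at hp
        exact hp.le
      exact Filter.tendsto_inv₀_cobounded.comp (f := fun w => pInv c r (-w⁻¹)) hGc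
  have hlim : Tendsto f (𝓝[uhp] (0 : ℂ)) (𝓝 0) := by
    set F := Ultrafilter.of (map (fun y : ℝ => (y : ℂ) * Complex.I) (𝓝[>] 0)) with hFd
    have hF : (F : Filter ℂ) ≤ 𝓝[uhp] 0 := (Ultrafilter.of_le _).trans tendsto_mul_I
    obtain ⟨k, hk, hkt⟩ := H F hF
    suffices h : k = 0 by
      rw [h] at hkt
      rw [← Complex.ofReal_zero] at H hF ⊢
      exact tendsto_of_finite_cluster ((finite_range _).insert 0) hcont H hF hkt
    rcases hk with hk | ⟨i, hi⟩
    · exact hk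
    · exfalso
      have hri : (r i : ℂ) ≠ 0 := by exact_mod_cast (hr i).ne'
      have h1 : Tendsto (fun w => pInv c r (-w⁻¹)) F (𝓝 (r i : ℂ)) := by
        have := hkt.inv₀ (by rw [← hi]; exact inv_ne_zero hri)
        rw [← hi] at this
        simpa [hf] using this
      have h2 : ∀ᶠ w in (F : Filter ℂ), ‖pInv c r (-w⁻¹)‖ ≤ ‖(r i : ℂ) - pInv c r (-w⁻¹)‖ := by
        refine Ultrafilter.of_le _ ?_
        rw [mem_map]
        filter_upwards [self_mem_nhdsWithin] with y hy
        have hy' : 0 < y := hy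
        have h3 : -((y : ℂ) * Complex.I)⁻¹ = ((y⁻¹ : ℝ) : ℂ) * Complex.I := by
          rw [mul_inv, Complex.inv_I]; push_cast; ring
        have h4 := norm_sub_ge (z := -((y : ℂ) * Complex.I)⁻¹) hM hr hc hc1
          (by rw [h3]; simpa using hy') i
        have h5 : (-((y : ℂ) * Complex.I)⁻¹).im = y⁻¹ := by rw [h3]; simp
        have h6 : ‖(-((y : ℂ) * Complex.I)⁻¹)‖ = y⁻¹ := by rw [h3]; simp [abs_of_pos hy']
        rw [h5, h6] at h4
        exact le_of_mul_le_mul_left h4 (by positivity)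
      have h3 := le_of_tendsto_of_tendsto h1.norm (h1.const_sub (r i : ℂ)).norm h2
      rw [sub_self, norm_zero] at h3
      exact hri (norm_le_zero_iff.1 h3)
  have h1 := hlim.comp tendsto_neg_inv_uhp'
  have h2 : Tendsto (fun z => ((pInv c r z)⁻¹)) (cobounded ℂ ⊓ 𝓟 uhp) (𝓝[≠] 0) := by
    refine tendsto_nhdsWithin_iff.2 ⟨h1.congr fun z => by simp [hf], ?_⟩
    filter_upwards [mem_inf_of_right (mem_principal_self _)] with z hz
    exact inv_ne_zero (ne_zero_of_im_pos (pInv_mem hM hr hc hc1 hz).1)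
  exact (Filter.tendsto_inv₀_nhdsNE_zero.comp h2).congr fun z => by simp

end Canonical

end

/-! ### Cauchy integral formula in the upper half-plane. -/

noncomputable section

namespace Canonical

open scoped ComplexConjugate

/-- The closed upper half-plane. -/
abbrev cuhp : Set ℂ := {z : ℂ | 0 ≤ z.im}

/-- Cauchy's theorem for the half-plane. -/
lemma integral_eq_zero_of_decay {Q : ℂ → ℂ} (hc : ContinuousOn Q cuhp)
    (hd : DifferentiableOn ℂ Q uhp) {C R₀ : ℝ}
    (hC : ∀ w : ℂ, 0 ≤ w.im → R₀ ≤ ‖w‖ → ‖Q w‖ ≤ C * ‖w‖ ^ (-(5 / 3) : ℝ)) :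
    ∫ x : ℝ, Q x = 0 := by
  by_cases hi : Integrable (fun x : ℝ => Q x)
  swap
  · exact integral_undef hi
  have h1 : Tendsto (fun X : ℝ => ∫ x in (-X)..X, Q x) atTop (𝓝 (∫ x : ℝ, Q x)) :=
    intervalIntegral_tendsto_integral hi tendsto_neg_atTop_atBot tendsto_id
  refine tendsto_nhds_unique h1 ?_
  -- The three sides of the rectangle off the real axis have total length `4 X`, and the integrand
  -- there is at most `|C| X^(-5/3)`.
  have h2 : Tendsto (fun X : ℝ => 4 * |C| * X ^ (-(2 / 3) : ℝ)) atTop (𝓝 0) := by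
    simpa using (tendsto_rpow_neg_atTop (y := 2 / 3) (by norm_num)).const_mul (4 * |C|)
  refine squeeze_zero_norm' ?_ h2
  filter_upwards [eventually_ge_atTop (max R₀ 1)] with X hX
  have hX0 : R₀ ≤ X := (le_max_left _ _).trans hX
  have hX1 : 1 ≤ X := (le_max_right _ _).trans hX
  have hXp : 0 < X := by linarith
  have hb : ∀ w : ℂ, 0 ≤ w.im → X ≤ ‖w‖ → ‖Q w‖ ≤ |C| * X ^ (-(5 / 3) : ℝ) := by
    intro w hw hXw
    refine (hC w hw (hX0.trans hXw)).trans ?_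
    gcongr ?_ * ?_
    · exact le_abs_self C
    · exact Real.rpow_le_rpow_of_nonpos hXp hXw (by norm_num)
  have hrect := Complex.integral_boundary_rect_eq_zero_of_continuousOn_of_differentiableOn Q
    ((-X : ℝ) : ℂ) ((X : ℂ) + X * Complex.I) (hc.mono (by
      intro w hw
      have := hw.2
      simp [uIcc_of_le hXp.le] at this
      exact this.1)) (hd.mono (by
      intro w hw
      have := hw.2
      simp [hXp.le] at this
      exact this.1))
  simp only [Complex.ofReal_re, Complex.ofReal_im, Complex.add_re, Complex.add_im, Complex.mul_re,
    Complex.mul_im, Complex.I_re, Complex.I_im, Complex.ofReal_zero, zero_mul, mul_zero, mul_one,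
    add_zero, zero_add, sub_zero] at hrect
  have b1 : ‖∫ x in (-X)..X, Q (x + X * Complex.I)‖ ≤ |C| * X ^ (-(5 / 3) : ℝ) * |X - -X| := by
    refine intervalIntegral.norm_integral_le_of_norm_le_const fun x _ => hb _ (by simp [hXp.le]) ?_
    refine le_trans ?_ (Complex.abs_im_le_norm _)
    simp [le_abs_self]
  have b2 : ‖∫ y in (0 : ℝ)..X, Q (X + y * Complex.I)‖ ≤ |C| * X ^ (-(5 / 3) : ℝ) * |X - 0| := by
    refine intervalIntegral.norm_integral_le_of_norm_le_const fun y hy => hb _ ?_ ?_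
    · rw [uIoc_of_le hXp.le] at hy
      simp [hy.1.le]
    · refine le_trans ?_ (Complex.abs_re_le_norm _)
      simp [le_abs_self]
  have b3 : ‖∫ y in (0 : ℝ)..X, Q ((-X : ℝ) + y * Complex.I)‖
      ≤ |C| * X ^ (-(5 / 3) : ℝ) * |X - 0| := by
    refine intervalIntegral.norm_integral_le_of_norm_le_const fun y hy => hb _ ?_ ?_
    · rw [uIoc_of_le hXp.le] at hy
      simp [hy.1.le]
    · refine le_trans ?_ (Complex.abs_re_le_norm _)
      simp [le_abs_self]
  have h3 : ∫ x in (-X)..X, Q x = (∫ x in (-X)..X, Q (x + X * Complex.I))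
      - Complex.I • (∫ y in (0 : ℝ)..X, Q (X + y * Complex.I))
      + Complex.I • (∫ y in (0 : ℝ)..X, Q ((-X : ℝ) + y * Complex.I)) := by
    linear_combination hrect
  have h4 : X ^ (-(5 / 3) : ℝ) * X = X ^ (-(2 / 3) : ℝ) := by
    rw [← Real.rpow_add_one hXp.ne']; norm_num
  rw [h3]
  refine (norm_add_le _ _).trans ((add_le_add_left (norm_sub_le _ _) _).trans ?_)
  rw [norm_smul, norm_smul, Complex.norm_I, one_mul, one_mul]
  rw [abs_of_pos (by linarith : 0 < X - -X)] at b1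
  rw [sub_zero, abs_of_pos hXp] at b2 b3
  calc _ ≤ _ := add_le_add (add_le_add b1 b2) b3
    _ = _ := by rw [← h4]; ring

lemma poisson_eq (x a : ℝ) {b : NNReal} (hb : (0 : ℝ) < b) :
    (b : ℝ) / ((a - x) ^ 2 + b ^ 2) = Real.pi * ProbabilityTheory.cauchyPDFReal x b a := by
  rw [ProbabilityTheory.cauchyPDFReal_def]
  have : 0 < (a - x) ^ 2 + (b : ℝ) ^ 2 := by positivity
  field_simp

lemma integrable_poisson (x : ℝ) {b : ℝ} (hb : 0 < b) :
    Integrable (fun a : ℝ => b / ((a - x) ^ 2 + b ^ 2)) := by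
  lift b to NNReal using hb.le
  simp_rw [poisson_eq x _ hb]
  exact (ProbabilityTheory.integrable_cauchyPDFReal x).const_mul _

lemma integral_poisson (x : ℝ) {b : ℝ} (hb : 0 < b) :
    ∫ a : ℝ, b / ((a - x) ^ 2 + b ^ 2) = Real.pi := by
  lift b to NNReal using hb.le
  simp_rw [poisson_eq x _ hb]
  rw [integral_const_mul, ProbabilityTheory.integral_cauchyPDFReal_eq_one x
    (by exact_mod_cast hb.ne'), mul_one]

lemma ofReal_sub_ne {z : ℂ} (hz : z.im ≠ 0) (x : ℝ) : (x : ℂ) - z ≠ 0 := fun h => by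
  apply hz
  have := congrArg Complex.im h
  simpa using this

lemma exists_norm_inv_le {z : ℂ} (hz : z.im ≠ 0) :
    ∃ K : ℝ, 0 < K ∧ ∀ x : ℝ, ‖(x : ℂ) - z‖⁻¹ ≤ K * (1 + |x|)⁻¹ := by
  have hy : 0 < |z.im| := abs_pos.2 hz
  refine ⟨1 + (1 + ‖z‖) / |z.im|, by positivity, fun x => ?_⟩
  have h0 := norm_pos_iff.2 (ofReal_sub_ne hz x)
  have h1 : |z.im| ≤ ‖(x : ℂ) - z‖ := by
    have := Complex.abs_im_le_norm ((x : ℂ) - z)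
    simpa using this
  have h2 : |x| ≤ ‖(x : ℂ) - z‖ + ‖z‖ := by
    have := norm_add_le ((x : ℂ) - z) z
    simpa using this
  rw [inv_le_iff_one_le_mul₀ h0]
  have h3 : 1 + |x| ≤ (1 + (1 + ‖z‖) / |z.im|) * ‖(x : ℂ) - z‖ := by
    have : (1 + ‖z‖) ≤ (1 + ‖z‖) / |z.im| * ‖(x : ℂ) - z‖ := by
      rw [div_mul_eq_mul_div, le_div_iff₀ hy]
      gcongr
    linarith
  have h4 : 0 < 1 + |x| := by positivity
  rw [mul_right_comm, ← div_eq_mul_inv, le_div_iff₀ h4]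
  linarith

/-- The exponent `2/3` is below one at the origin, and `5/3` is above one at infinity. This function
dominates the boundary integrands uniformly. -/
lemma integrable_abs_rpow_mul : Integrable (fun x : ℝ => |x| ^ (-(2 / 3) : ℝ) * (1 + |x|)⁻¹) := by
  set D : ℝ → ℝ := fun x => |x| ^ (-(2 / 3) : ℝ) * (1 + |x|)⁻¹ with hD
  have hmeas : Measurable D := by fun_prop
  have h1 : IntegrableOn D (Ioc 0 1) := by
    have : IntegrableOn (fun x : ℝ => x ^ (-(2 / 3) : ℝ)) (Ioc 0 1) := by
      rw [← intervalIntegrable_iff_integrableOn_Ioc_of_le zero_le_one]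
      exact intervalIntegral.intervalIntegrable_rpow' (by norm_num)
    refine Integrable.mono' this hmeas.aestronglyMeasurable ?_
    refine ae_restrict_of_forall_mem measurableSet_Ioc fun x hx => ?_
    have hx0 := hx.1
    simp only [hD, abs_of_pos hx0]
    rw [Real.norm_of_nonneg (by positivity)]
    exact mul_le_of_le_one_right (by positivity) (inv_le_one_of_one_le₀ (by linarith))
  have h2 : IntegrableOn D (Ioi 1) := by
    have : IntegrableOn (fun x : ℝ => x ^ (-(5 / 3) : ℝ)) (Ioi 1) :=
      integrableOn_Ioi_rpow_of_lt (by norm_num) zero_lt_one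
    refine Integrable.mono' this hmeas.aestronglyMeasurable ?_
    refine ae_restrict_of_forall_mem measurableSet_Ioi fun x hx => ?_
    have hx0 : 0 < x := zero_lt_one.trans hx
    simp only [hD, abs_of_pos hx0]
    rw [Real.norm_of_nonneg (by positivity)]
    have : x ^ (-(5 / 3) : ℝ) = x ^ (-(2 / 3) : ℝ) * x⁻¹ := by
      rw [← Real.rpow_neg_one, ← Real.rpow_add hx0]; norm_num
    rw [this]
    gcongr
    linarith
  have h3 : IntegrableOn D (Ioi 0) := by
    rw [← Ioc_union_Ioi_eq_Ioi zero_le_one]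
    exact h1.union h2
  have h4 : IntegrableOn D (Iic 0) := by
    have := h3.comp_neg
    simp only [neg_Ioi, neg_zero] at this
    rw [integrableOn_Iic_iff_integrableOn_Iio]
    refine this.congr_fun (fun x _ => ?_) measurableSet_Iio
    simp [hD]
  rw [← integrableOn_univ, ← Iic_union_Ioi (a := (0 : ℝ))]
  exact h4.union h3

lemma integrable_abs_rpow_mul_inv (C : ℝ) {z : ℂ} (hz : z.im ≠ 0) :
    Integrable (fun x : ℝ => C * |x| ^ (-(2 / 3) : ℝ) * ‖(x : ℂ) - z‖⁻¹) := by
  obtain ⟨K, hK, h⟩ := exists_norm_inv_le hz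
  refine (integrable_abs_rpow_mul.const_mul (|C| * K)).mono' ?_ (Eventually.of_forall fun x => ?_)
  · exact Measurable.aestronglyMeasurable (by fun_prop)
  · have h0 : 0 ≤ |x| ^ (-(2 / 3) : ℝ) := by positivity
    rw [norm_mul, norm_mul, Real.norm_eq_abs, Real.norm_of_nonneg h0, norm_inv, norm_norm]
    calc _ ≤ |C| * |x| ^ (-(2 / 3) : ℝ) * (K * (1 + |x|)⁻¹) := by gcongr; exact h x
      _ = _ := by ring

/-- Half-plane Cauchy formula for functions continuous up to the boundary. -/
lemma integral_im_of_continuousOn {F : ℂ → ℂ} (hc : ContinuousOn F cuhp)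
    (hd : DifferentiableOn ℂ F uhp) {C : ℝ}
    (hC : ∀ w : ℂ, 0 ≤ w.im → w ≠ 0 → ‖F w‖ ≤ C * ‖w‖ ^ (-(2 / 3) : ℝ)) {z : ℂ} (hz : 0 < z.im) :
    ∫ x : ℝ, ((F x).im : ℂ) / (x - z) = Real.pi * F z := by
  have hC0 : 0 ≤ C := by
    have := hC 1 (by simp) one_ne_zero
    simp at this
    exact (norm_nonneg _).trans this
  have hzn : z ≠ 0 := ne_zero_of_im_pos hz
  have hcz : (conj z).im ≠ 0 := by simpa using hz.ne'
  have hne : ∀ w : ℂ, 0 ≤ w.im → w - conj z ≠ 0 := fun w hw h => by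
    have := congrArg Complex.im h
    simp at this
    linarith
  have hFm : AEStronglyMeasurable (fun x : ℝ => F x) := by
    refine Continuous.aestronglyMeasurable ?_
    exact hc.comp_continuous Complex.continuous_ofReal (fun x => by simp)
  have hmeas : ∀ u : ℂ, Measurable (fun x : ℝ => ((x : ℂ) - u)⁻¹) := fun u => by fun_prop
  have hint : ∀ u : ℂ, u.im ≠ 0 → Integrable (fun x : ℝ => F x / (x - u)) := fun u hu => by
    refine (integrable_abs_rpow_mul_inv C hu).mono' ?_ ?_
    · simp_rw [div_eq_mul_inv]
      exact hFm.mul (hmeas u).aestronglyMeasurable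
    · filter_upwards [Measure.ae_ne volume (0 : ℝ)] with x hx
      rw [norm_div, div_eq_mul_inv]
      have := hC x (by simp) (by exact_mod_cast hx)
      rw [Complex.norm_real, Real.norm_eq_abs] at this
      gcongr
  have hfar : ∀ u w : ℂ, 2 * ‖u‖ ≤ ‖w‖ → ‖w‖ / 2 ≤ ‖w - u‖ := fun u w h => by
    have := norm_sub_norm_le w u
    linarith
  -- the conjugate point
  have hI2 : ∫ x : ℝ, F x / (x - conj z) = 0 := by
    refine integral_eq_zero_of_decay (Q := fun w => F w / (w - conj z))
      (hc.div (by fun_prop) hne) (hd.div (by fun_prop) fun w hw => hne w (le_of_lt hw))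
      (C := 2 * C) (R₀ := 2 * ‖z‖ + 1) fun w hw hwR => ?_
    have hwp : 0 < ‖w‖ := by linarith [norm_nonneg z]
    have h1 := hC w hw (norm_pos_iff.1 hwp)
    have h2 := hfar (conj z) w (by rw [Complex.norm_conj]; linarith)
    have h3 : ‖w‖ ^ (-(5 / 3) : ℝ) = ‖w‖ ^ (-(2 / 3) : ℝ) * ‖w‖⁻¹ := by
      rw [← Real.rpow_neg_one, ← Real.rpow_add hwp]; norm_num
    rw [norm_div]
    calc _ ≤ C * ‖w‖ ^ (-(2 / 3) : ℝ) / (‖w‖ / 2) := by gcongr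
      _ = _ := by rw [h3]; field_simp
  -- the Poisson kernel
  have hI1 : ∫ x : ℝ, dslope F z x / (x - conj z) = 0 := by
    have hFz : DifferentiableAt ℂ F z :=
      (hd z hz).differentiableAt ((isOpen_lt continuous_const Complex.continuous_im).mem_nhds hz)
    have hu : uhp ∈ 𝓝 z := (isOpen_lt continuous_const Complex.continuous_im).mem_nhds hz
    refine integral_eq_zero_of_decay (Q := fun w => dslope F z w / (w - conj z))
      (ContinuousOn.div ?_ (by fun_prop) hne)
      (DifferentiableOn.div ?_ (by fun_prop) fun w hw => hne w (le_of_lt hw))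
      (C := 4 * (C + ‖F z‖)) (R₀ := 2 * ‖z‖ + 1) fun w hw hwR => ?_
    · exact (continuousOn_dslope (s := cuhp) (mem_of_superset hu fun w hw => show 0 ≤ w.im from le_of_lt hw)).2 ⟨hc, hFz⟩
    · exact (Complex.differentiableOn_dslope hu).2 hd
    · have hw1 : 1 ≤ ‖w‖ := by linarith [norm_nonneg z]
      have hwp : 0 < ‖w‖ := by linarith
      have hwz : w ≠ z := by rintro rfl; linarith [norm_nonneg w]
      have h1 := hC w hw (norm_pos_iff.1 hwp)
      have h1' : ‖F w‖ ≤ C := by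
        refine h1.trans (mul_le_of_le_one_right hC0 ?_)
        exact Real.rpow_le_one_of_one_le_of_nonpos hw1 (by norm_num)
      have h2 := hfar (conj z) w (by rw [Complex.norm_conj]; linarith)
      have h2' := hfar z w (by linarith)
      have h3 : ‖w‖ ^ (-2 : ℝ) ≤ ‖w‖ ^ (-(5 / 3) : ℝ) :=
        Real.rpow_le_rpow_of_exponent_le hw1 (by norm_num)
      rw [norm_div, dslope_of_ne _ hwz, slope_def_field, norm_div]
      have h4 : ‖F w - F z‖ ≤ C + ‖F z‖ := (norm_sub_le _ _).trans (by gcongr)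
      calc _ ≤ (C + ‖F z‖) / (‖w‖ / 2) / (‖w‖ / 2) := by gcongr
        _ = 4 * (C + ‖F z‖) * ‖w‖ ^ (-2 : ℝ) := by
          rw [Real.rpow_neg hwp.le, Real.rpow_ofNat]; field_simp; norm_num
        _ ≤ _ := by gcongr
  have hP : ∀ x : ℝ, ((x : ℂ) - z) * (x - conj z) = (((x - z.re) ^ 2 + z.im ^ 2 : ℝ) : ℂ) := by
    intro x
    have : (x : ℂ) - conj z = conj ((x : ℂ) - z) := by simp
    rw [this, Complex.mul_conj, Complex.normSq_apply]
    simp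
    ring
  have hI3 : ∫ x : ℝ, F x / (x - z) = 2 * Complex.I * Real.pi * F z := by
    -- Subtracting the same quotient with pole at `conj z` leaves `F x` times `2 i` times the
    -- Poisson kernel; then `F x = F z + (x - z) dslope F z x`. Only the `F z` term survives
    -- integration.
    have e1 : ∀ x : ℝ, F x / (x - z) = F x / (x - conj z)
        + (2 * Complex.I * z.im) * (dslope F z x / (x - conj z))
        + (2 * Complex.I * F z) * ((z.im / ((x - z.re) ^ 2 + z.im ^ 2) : ℝ) : ℂ) := by
      intro x
      have n1 := ofReal_sub_ne hz.ne' x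
      have n2 := ofReal_sub_ne hcz x
      have n3 : (x : ℂ) ≠ z := ofReal_ne_of_im_pos hz x
      have n4 : z - conj z = 2 * Complex.I * z.im := by
        apply Complex.ext <;> simp; ring
      rw [dslope_of_ne _ n3, slope_def_field, Complex.ofReal_div, ← hP, mul_assoc 2,
        mul_assoc 2 Complex.I (F z)]
      have n5 : 2 * (Complex.I * (z.im : ℂ)) = z - conj z := by rw [n4]; ring
      field_simp
      linear_combination (-F z + F z) * n5 + (-F x) * n5
    have i3 : Integrable (fun x : ℝ =>
        (2 * Complex.I * F z) * ((z.im / ((x - z.re) ^ 2 + z.im ^ 2) : ℝ) : ℂ)) :=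
      (integrable_poisson z.re hz).ofReal.const_mul _
    have i1 := hint z hz.ne'
    have i2 := hint _ hcz
    -- Integrability of the divided-difference term is read off from that of the three others in
    -- `e1`.
    have i4 : Integrable (fun x : ℝ => (2 * Complex.I * z.im) * (dslope F z x / (x - conj z))) := by
      refine ((i1.sub i2).sub i3).congr (Eventually.of_forall fun x => ?_)
      simp only [Pi.sub_apply]
      rw [e1 x]; ring
    simp_rw [e1]
    have a1 := integral_add (i2.add i4) i3
    have a2 := integral_add i2 i4
    simp only [Pi.add_apply] at a1 a2
    rw [a1, a2, hI2, integral_const_mul, hI1,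
      integral_const_mul, integral_complex_ofReal, integral_poisson z.re hz]
    ring
  have hI4 : ∫ x : ℝ, conj (F x) / (x - z) = 0 := by
    have : ∀ x : ℝ, conj (F x) / ((x : ℂ) - z) = conj (F x / (x - conj z)) := fun x => by simp
    simp_rw [this]
    rw [integral_conj, hI2, map_zero]
  have i5 : Integrable (fun x : ℝ => conj (F x) / ((x : ℂ) - z)) := by
    have : ∀ x : ℝ, conj (F x) / ((x : ℂ) - z) = conj (F x / (x - conj z)) := fun x => by simp
    simp_rw [this]
    exact (hint _ hcz).norm.mono' (Complex.continuous_conj.comp_aestronglyMeasurable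
      (hint _ hcz).aestronglyMeasurable) (Eventually.of_forall fun x => by rw [Complex.norm_conj])
  -- Writing `Im F = (F - conj F) / (2 i)`, the conjugate part contributes nothing by `hI4`.
  have e2 : ∀ x : ℝ, ((F x).im : ℂ) / (x - z)
      = (2 * Complex.I)⁻¹ * (F x / (x - z) - conj (F x) / (x - z)) := fun x => by
    have : F x - conj (F x) = 2 * Complex.I * (F x).im := by
      apply Complex.ext <;> simp; ring
    rw [← sub_div, this]
    field_simp
  simp_rw [e2]
  rw [integral_const_mul, integral_sub (hint z hz.ne') i5, hI3, hI4]
  field_simp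
  ring

/-- Half-plane Cauchy formula with an integrable singularity at the origin. -/
lemma integral_im_eq {m : ℂ → ℂ} (hc : ContinuousOn m (cuhp \ {0}))
    (hd : DifferentiableOn ℂ m uhp) {C : ℝ}
    (hC : ∀ w : ℂ, 0 ≤ w.im → w ≠ 0 → ‖m w‖ ≤ C * ‖w‖ ^ (-(2 / 3) : ℝ)) {z : ℂ} (hz : 0 < z.im) :
    ∫ x : ℝ, ((m x).im : ℂ) / (x - z) = Real.pi * m z := by
  have hC0 : 0 ≤ C := by
    have := hC 1 (by simp) one_ne_zero
    simp at this
    exact (norm_nonneg _).trans this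
  -- The function is translated upwards to remove the singularity. The bound survives with the same
  -- constant, since `|w + i ε| ≥ |w|` in the closed half-plane and the exponent is negative;
  -- dominated convergence then applies.
  set ε : ℕ → ℝ := fun n => 1 / ((n : ℝ) + 1) with hε
  have hεp : ∀ n, 0 < ε n := fun n => by positivity
  have hε0 : Tendsto ε atTop (𝓝 0) := tendsto_one_div_add_atTop_nhds_zero_nat
  have hadd : ∀ w : ℂ, Tendsto (fun n => w + ε n * Complex.I) atTop (𝓝 w) := fun w => by
    have h1 : Continuous (fun e : ℝ => w + e * Complex.I) := by fun_prop
    simpa [Function.comp_def] using (h1.tendsto 0).comp hε0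
  have him : ∀ n (w : ℂ), 0 ≤ w.im → 0 < (w + ε n * Complex.I).im := fun n w hw => by
    simp
    linarith [hεp n]
  have hbd : ∀ n (w : ℂ), 0 ≤ w.im → w ≠ 0 →
      ‖m (w + ε n * Complex.I)‖ ≤ C * ‖w‖ ^ (-(2 / 3) : ℝ) := fun n w hw hw0 => by
    have h1 := him n w hw
    refine (hC _ h1.le (ne_zero_of_im_pos h1)).trans ?_
    refine mul_le_mul_of_nonneg_left ?_ hC0
    refine Real.rpow_le_rpow_of_nonpos (norm_pos_iff.2 hw0) ?_ (by norm_num)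
    refine (sq_le_sq₀ (norm_nonneg _) (norm_nonneg _)).1 ?_
    rw [← Complex.normSq_eq_norm_sq, ← Complex.normSq_eq_norm_sq, Complex.normSq_apply,
      Complex.normSq_apply]
    simp
    nlinarith [hεp n, mul_nonneg hw (hεp n).le]
  have hcon : ∀ w : ℂ, 0 ≤ w.im → w ≠ 0 →
      Tendsto (fun n => m (w + ε n * Complex.I)) atTop (𝓝 (m w)) := fun w hw hw0 => by
    refine (hc w ⟨hw, hw0⟩).tendsto.comp (tendsto_nhdsWithin_iff.2 ⟨hadd w, ?_⟩)
    exact Eventually.of_forall fun n => ⟨(him n w hw).le, ne_zero_of_im_pos (him n w hw)⟩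
  have hmaps : ∀ n, ∀ w ∈ cuhp, w + ε n * Complex.I ∈ cuhp \ {0} := fun n w hw =>
    ⟨(him n w hw).le, ne_zero_of_im_pos (him n w hw)⟩
  have hcn : ∀ n, ContinuousOn (fun w => m (w + ε n * Complex.I)) cuhp := fun n =>
    hc.comp (by fun_prop) (hmaps n)
  have hn : ∀ n, ∫ x : ℝ, ((m (x + ε n * Complex.I)).im : ℂ) / (x - z)
      = Real.pi * m (z + ε n * Complex.I) := fun n => by
    refine integral_im_of_continuousOn (F := fun w => m (w + ε n * Complex.I)) (hcn n) ?_
      (hbd n) hz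
    exact hd.comp (by fun_prop) fun w hw => him n w (le_of_lt hw)
  have hlim : Tendsto (fun n => ∫ x : ℝ, ((m (x + ε n * Complex.I)).im : ℂ) / (x - z)) atTop
      (𝓝 (∫ x : ℝ, ((m x).im : ℂ) / (x - z))) := by
    refine tendsto_integral_of_dominated_convergence _ (fun n => ?_)
      (integrable_abs_rpow_mul_inv C hz.ne') (fun n => ?_) ?_
    · have h1 : Continuous fun x : ℝ => m (x + ε n * Complex.I) :=
        (hcn n).comp_continuous Complex.continuous_ofReal (fun x => by simp)
      refine Continuous.aestronglyMeasurable ?_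
      exact (Complex.continuous_ofReal.comp (Complex.continuous_im.comp h1)).div (by fun_prop)
        fun x => ofReal_sub_ne hz.ne' x
    · filter_upwards [Measure.ae_ne volume (0 : ℝ)] with x hx
      rw [norm_div, div_eq_mul_inv, Complex.norm_real, Real.norm_eq_abs]
      have := hbd n x (by simp) (by exact_mod_cast hx)
      rw [Complex.norm_real, Real.norm_eq_abs] at this
      gcongr
      exact (Complex.abs_im_le_norm _).trans this
    · filter_upwards [Measure.ae_ne volume (0 : ℝ)] with x hx
      have h1 := hcon x (by simp) (by exact_mod_cast hx)
      exact ((Complex.continuous_ofReal.tendsto _).comp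
        ((Complex.continuous_im.tendsto _).comp h1)).div_const _
  refine tendsto_nhds_unique hlim ?_
  simp_rw [hn]
  exact (hcon z hz.le (ne_zero_of_im_pos hz)).const_mul _

end Canonical

end

/-! ### Uniqueness of a measure with given Stieltjes transform. -/

noncomputable section

namespace Canonical

lemma integrable_inv_sub (μ : Measure ℝ) [IsFiniteMeasure μ] {z : ℂ} (hz : 0 < z.im) :
    Integrable (fun x : ℝ => ((x : ℂ) - z)⁻¹) μ := by
  refine (integrable_const (z.im)⁻¹).mono' (Measurable.aestronglyMeasurable (by fun_prop))
    (Eventually.of_forall fun x => ?_)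
  rw [norm_inv]
  refine inv_anti₀ hz ?_
  have := Complex.abs_im_le_norm ((x : ℂ) - z)
  simpa [abs_of_pos hz] using this

lemma im_inv_sub (a b x : ℝ) :
    (((x : ℂ) - (a + b * Complex.I))⁻¹).im = b / ((a - x) ^ 2 + b ^ 2) := by
  rw [Complex.inv_im, Complex.normSq_apply]
  simp
  ring

lemma im_stieltjes (μ : Measure ℝ) [IsFiniteMeasure μ] (a : ℝ) {b : ℝ} (hb : 0 < b) :
    (∫ x : ℝ, ((x : ℂ) - (a + b * Complex.I))⁻¹ ∂μ).im = ∫ x, b / ((a - x) ^ 2 + b ^ 2) ∂μ := by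
  have h := integrable_inv_sub μ (z := a + b * Complex.I) (by simpa using hb)
  have := integral_im h
  simp only [RCLike.im_eq_complex_im, im_inv_sub] at this
  exact this.symm

/-- Integrating a bounded continuous function against the Poisson smoothing of a measure. -/
lemma integral_poisson_smoothing (μ : Measure ℝ) [IsFiniteMeasure μ]
    (f : BoundedContinuousFunction ℝ ℝ) {b : ℝ} (hb : 0 < b) :
    ∫ x, (∫ u, f (x + b * u) * (1 + u ^ 2)⁻¹) ∂μ
      = ∫ a, f a * ∫ x, b / ((a - x) ^ 2 + b ^ 2) ∂μ := by
  have hpos : ∀ v : ℝ, 0 < v ^ 2 + b ^ 2 := fun v => by positivity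
  have h1 : ∀ x : ℝ, ∫ u, f (x + b * u) * (1 + u ^ 2)⁻¹
      = ∫ a, f a * (b / ((a - x) ^ 2 + b ^ 2)) := fun x => by
    -- Substitution `a = x + b u`, as a dilation followed by a translation.
    have e1 := Measure.integral_comp_mul_left (fun v : ℝ => f (x + v) * (b / (v ^ 2 + b ^ 2))) b
    have e2 := integral_add_left_eq_self (μ := volume)
      (fun a : ℝ => f a * (b / ((a - x) ^ 2 + b ^ 2))) x
    simp only [add_sub_cancel_left] at e2
    rw [e2, smul_eq_mul, abs_of_pos (inv_pos.2 hb)] at e1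
    have e3 : ∀ u : ℝ, f (x + b * u) * (b / ((b * u) ^ 2 + b ^ 2))
        = b⁻¹ * (f (x + b * u) * (1 + u ^ 2)⁻¹) := fun u => by
      have := hpos (b * u)
      have : 0 < 1 + u ^ 2 := by positivity
      field_simp
      ring
    simp_rw [e3] at e1
    rw [integral_const_mul] at e1
    exact mul_left_cancel₀ (inv_ne_zero hb.ne') e1
  simp_rw [h1]
  have hmeas : AEStronglyMeasurable
      (Function.uncurry fun x a : ℝ => f a * (b / ((a - x) ^ 2 + b ^ 2))) (μ.prod volume) := by
    refine Continuous.aestronglyMeasurable ?_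
    refine (f.continuous.comp continuous_snd).mul (continuous_const.div (by fun_prop) ?_)
    exact fun p => (hpos _).ne'
  have hint : ∀ x : ℝ, Integrable (fun a : ℝ => f a * (b / ((a - x) ^ 2 + b ^ 2))) := fun x => by
    refine (integrable_poisson x hb).bdd_mul (c := ‖f‖) f.continuous.aestronglyMeasurable
      (Eventually.of_forall fun a => f.norm_coe_le_norm a)
  suffices h2 : Integrable
      (Function.uncurry fun x a : ℝ => f a * (b / ((a - x) ^ 2 + b ^ 2))) (μ.prod volume) by
    rw [integral_integral_swap h2]
    congr 1
    ext a
    rw [integral_const_mul]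
  rw [integrable_prod_iff hmeas]
  refine ⟨Eventually.of_forall hint, ?_⟩
  refine (integrable_const (‖f‖ * Real.pi)).mono' hmeas.norm.integral_prod_right'
    (Eventually.of_forall fun x => ?_)
  rw [Real.norm_of_nonneg (integral_nonneg fun a => norm_nonneg _), ← integral_poisson x hb,
    ← integral_const_mul]
  refine integral_mono (hint x).norm ((integrable_poisson x hb).const_mul _) fun a => ?_
  have := hpos (a - x)
  simp only [Function.uncurry_apply_pair, norm_mul]
  rw [Real.norm_of_nonneg (by positivity : 0 ≤ b / ((a - x) ^ 2 + b ^ 2))]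
  gcongr
  exact f.norm_coe_le_norm a

/-- The rescaled kernels form an approximate identity of mass `π`; dominated convergence is used
first in `u`, then against `μ`. -/
lemma tendsto_integral_poisson (μ : Measure ℝ) [IsFiniteMeasure μ]
    (f : BoundedContinuousFunction ℝ ℝ) {b : ℕ → ℝ} (hb : Tendsto b atTop (𝓝 0)) :
    Tendsto (fun n => ∫ x, (∫ u, f (x + b n * u) * (1 + u ^ 2)⁻¹) ∂μ) atTop
      (𝓝 (∫ x, f x * Real.pi ∂μ)) := by
  have hbd : ∀ y u : ℝ, ‖f y * (1 + u ^ 2)⁻¹‖ ≤ ‖f‖ * (1 + u ^ 2)⁻¹ := fun y u => by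
    rw [norm_mul, Real.norm_of_nonneg (by positivity : 0 ≤ (1 + u ^ 2)⁻¹)]
    gcongr
    exact f.norm_coe_le_norm y
  refine tendsto_integral_of_dominated_convergence (μ := μ) (fun _ => ‖f‖ * Real.pi) (fun n => ?_)
    (integrable_const _) (fun n => Eventually.of_forall fun x => ?_)
    (Eventually.of_forall fun x => ?_)
  · have : Continuous (Function.uncurry fun x u : ℝ => f (x + b n * u) * (1 + u ^ 2)⁻¹) := by
      refine (f.continuous.comp (by fun_prop)).mul (Continuous.inv₀ (by fun_prop) ?_)
      intro p
      positivity
    exact (this.stronglyMeasurable.integral_prod_right (ν := volume)).aestronglyMeasurable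
  · rw [← integral_univ_inv_one_add_sq, ← integral_const_mul]
    exact norm_integral_le_of_norm_le (integrable_inv_one_add_sq.const_mul _)
      (Eventually.of_forall fun u => hbd _ u)
  · rw [← integral_univ_inv_one_add_sq, ← integral_const_mul]
    refine tendsto_integral_of_dominated_convergence (fun u => ‖f‖ * (1 + u ^ 2)⁻¹) (fun n => ?_)
      (integrable_inv_one_add_sq.const_mul _) (fun n => Eventually.of_forall fun u => hbd _ u)
      (Eventually.of_forall fun u => ?_)
    · refine Measurable.aestronglyMeasurable ?_
      exact (f.continuous.measurable.comp (by fun_prop)).mul (by fun_prop)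
    · refine Tendsto.mul_const _ ?_
      have h1 : Continuous (fun e : ℝ => f (x + e * u)) := f.continuous.comp (by fun_prop)
      simpa [Function.comp_def] using (h1.tendsto 0).comp hb

/-- A finite measure is determined by its Stieltjes transform. -/
lemma eq_of_stieltjes_eq {μ ν : Measure ℝ} [IsFiniteMeasure μ] [IsFiniteMeasure ν]
    (h : ∀ z : ℂ, 0 < z.im → ∫ x : ℝ, ((x : ℂ) - z)⁻¹ ∂μ = ∫ x : ℝ, ((x : ℂ) - z)⁻¹ ∂ν) :
    μ = ν := by
  refine ext_of_forall_integral_eq_of_IsFiniteMeasure fun f => ?_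
  have hb : Tendsto (fun n : ℕ => 1 / ((n : ℝ) + 1)) atTop (𝓝 0) :=
    tendsto_one_div_add_atTop_nhds_zero_nat
  have h1 := tendsto_integral_poisson μ f hb
  have h2 := tendsto_integral_poisson ν f hb
  have h3 : ∀ n : ℕ, ∫ x, (∫ u, f (x + 1 / ((n : ℝ) + 1) * u) * (1 + u ^ 2)⁻¹) ∂μ
      = ∫ x, (∫ u, f (x + 1 / ((n : ℝ) + 1) * u) * (1 + u ^ 2)⁻¹) ∂ν := fun n => by
    have hp : 0 < 1 / ((n : ℝ) + 1) := by positivity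
    generalize 1 / ((n : ℝ) + 1) = e at hp
    rw [integral_poisson_smoothing μ f hp, integral_poisson_smoothing ν f hp]
    congr 1
    ext a
    rw [← im_stieltjes μ a hp, ← im_stieltjes ν a hp, h _ (by simpa using hp)]
  simp_rw [h3] at h1
  have h4 := tendsto_nhds_unique h1 h2
  rw [integral_mul_const, integral_mul_const] at h4
  exact mul_right_cancel₀ Real.pi_ne_zero h4

/-! ### Recovering a measure from the boundary values of its transform. -/

section Density

variable {m : ℂ → ℂ} {C : ℝ}

/-- The boundary density of a function on the upper half-plane. -/
def bdryDensity (m : ℂ → ℂ) (x : ℝ) : ℝ := (m x).im / Real.pi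

/-- The measure on `(0, ∞)` with density `bdryDensity m`. -/
def bdryMeasure (m : ℂ → ℂ) : Measure ℝ :=
  (volume.restrict (Ioi 0)).withDensity fun x => ENNReal.ofReal (bdryDensity m x)

lemma continuousOn_bdryDensity (hc : ContinuousOn m (cuhp \ {0})) :
    ContinuousOn (bdryDensity m) (Ioi 0) := by
  refine ContinuousOn.div_const ?_ _
  refine Complex.continuous_im.comp_continuousOn (hc.comp (by fun_prop) fun x hx => ?_)
  have hx' : (0 : ℝ) < x := hx
  exact ⟨show 0 ≤ ((x : ℂ)).im by simp, by simpa using hx'.ne'⟩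

lemma aemeasurable_bdryDensity (hc : ContinuousOn m (cuhp \ {0})) :
    AEMeasurable (bdryDensity m) (volume.restrict (Ioi 0)) :=
  (continuousOn_bdryDensity hc).aemeasurable measurableSet_Ioi

lemma integrableOn_bdryDensity_div (hc : ContinuousOn m (cuhp \ {0}))
    (hC : ∀ w : ℂ, 0 ≤ w.im → w ≠ 0 → ‖m w‖ ≤ C * ‖w‖ ^ (-(2 / 3) : ℝ)) {z : ℂ}
    (hz : 0 < z.im) : IntegrableOn (fun x : ℝ => (bdryDensity m x : ℂ) * ((x : ℂ) - z)⁻¹)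
      (Ioi 0) := by
  refine ((integrable_abs_rpow_mul_inv C hz.ne').integrableOn.const_mul Real.pi⁻¹).mono' ?_ ?_
  · refine AEStronglyMeasurable.mul ?_ (Measurable.aestronglyMeasurable (by fun_prop))
    exact Complex.continuous_ofReal.comp_aestronglyMeasurable
      (aemeasurable_bdryDensity hc).aestronglyMeasurable
  · refine ae_restrict_of_forall_mem measurableSet_Ioi fun x hx => ?_
    have hx' : (0 : ℝ) < x := hx
    have := hC x (by simp) (by exact_mod_cast hx'.ne')
    rw [Complex.norm_real, Real.norm_eq_abs] at this
    rw [norm_mul, norm_inv, Complex.norm_real, bdryDensity, norm_div, Real.norm_eq_abs,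
      Real.norm_of_nonneg Real.pi_pos.le, div_eq_inv_mul, mul_assoc]
    gcongr
    exact (Complex.abs_im_le_norm _).trans this

lemma setIntegral_bdryDensity (hc : ContinuousOn m (cuhp \ {0}))
    (hd : DifferentiableOn ℂ m uhp)
    (hC : ∀ w : ℂ, 0 ≤ w.im → w ≠ 0 → ‖m w‖ ≤ C * ‖w‖ ^ (-(2 / 3) : ℝ))
    (hneg : ∀ x : ℝ, x < 0 → (m x).im = 0) {z : ℂ} (hz : 0 < z.im) :
    ∫ x in Ioi (0 : ℝ), (bdryDensity m x : ℂ) * ((x : ℂ) - z)⁻¹ = m z := by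
  have h1 := integral_im_eq hc hd hC hz
  have h2 : ∀ x : ℝ, (bdryDensity m x : ℂ) * ((x : ℂ) - z)⁻¹
      = (Real.pi : ℂ)⁻¹ * (((m x).im : ℂ) / (x - z)) := fun x => by
    rw [bdryDensity]; push_cast; ring
  rw [setIntegral_eq_integral_of_ae_compl_eq_zero]
  · simp_rw [h2]
    rw [integral_const_mul, h1]
    have : (Real.pi : ℂ) ≠ 0 := by exact_mod_cast Real.pi_ne_zero
    field_simp
  · filter_upwards [Measure.ae_ne volume (0 : ℝ)] with x hx hx'
    rw [h2, hneg x (lt_of_le_of_ne (not_lt.1 hx') hx)]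
    simp

lemma stieltjes_bdryMeasure (hc : ContinuousOn m (cuhp \ {0}))
    (hd : DifferentiableOn ℂ m uhp)
    (hC : ∀ w : ℂ, 0 ≤ w.im → w ≠ 0 → ‖m w‖ ≤ C * ‖w‖ ^ (-(2 / 3) : ℝ))
    (hneg : ∀ x : ℝ, x < 0 → (m x).im = 0) (hpos : ∀ x : ℝ, 0 < x → 0 ≤ (m x).im)
    {z : ℂ} (hz : 0 < z.im) :
    ∫ x : ℝ, ((x : ℂ) - z)⁻¹ ∂(bdryMeasure m) = m z := by
  rw [bdryMeasure, integral_withDensity_eq_integral_toReal_smul₀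
    (aemeasurable_bdryDensity hc).ennreal_ofReal (Eventually.of_forall fun x => by simp),
    ← setIntegral_bdryDensity hc hd hC hneg hz]
  refine setIntegral_congr_fun measurableSet_Ioi fun x hx => ?_
  have : 0 ≤ bdryDensity m x := div_nonneg (hpos x hx) Real.pi_pos.le
  simp only [ENNReal.toReal_ofReal this, Complex.real_smul]

/-- The real part of `-iy m(iy)` is the integral of the density against `y² / (x² + y²)`, which
increases to one as `y → ∞`. Monotone convergence yields the mass without knowing beforehand that
the density is integrable. -/
lemma isProbabilityMeasure_bdryMeasure (hc : ContinuousOn m (cuhp \ {0}))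
    (hd : DifferentiableOn ℂ m uhp)
    (hC : ∀ w : ℂ, 0 ≤ w.im → w ≠ 0 → ‖m w‖ ≤ C * ‖w‖ ^ (-(2 / 3) : ℝ))
    (hneg : ∀ x : ℝ, x < 0 → (m x).im = 0) (hpos : ∀ x : ℝ, 0 < x → 0 ≤ (m x).im)
    (hlim : Tendsto (fun y : ℝ => -(y * Complex.I) * m (y * Complex.I)) atTop (𝓝 1)) :
    IsProbabilityMeasure (bdryMeasure m) := by
  have hg : ∀ x ∈ Ioi (0 : ℝ), 0 ≤ bdryDensity m x := fun x hx =>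
    div_nonneg (hpos x hx) Real.pi_pos.le
  set y : ℕ → ℝ := fun n => (n : ℝ) + 1 with hy
  have hyp : ∀ n, 0 < y n := fun n => by positivity
  have hyt : Tendsto y atTop atTop := tendsto_atTop_add_const_right _ _ tendsto_natCast_atTop_atTop
  have hre : ∀ n (x : ℝ), ((-(y n * Complex.I)) * ((bdryDensity m x : ℂ)
      * ((x : ℂ) - y n * Complex.I)⁻¹)).re = bdryDensity m x * (y n ^ 2 / (x ^ 2 + y n ^ 2)) := by
    intro n x
    have : (-(y n * Complex.I)) * ((bdryDensity m x : ℂ) * ((x : ℂ) - y n * Complex.I)⁻¹)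
      = ((bdryDensity m x * y n : ℝ) : ℂ) * ((-Complex.I) * ((x : ℂ) - y n * Complex.I)⁻¹) := by
      push_cast; ring
    rw [this, Complex.re_ofReal_mul, Complex.mul_re, Complex.inv_re, Complex.inv_im,
      Complex.normSq_apply]
    simp
    ring
  have hint : ∀ n, IntegrableOn (fun x : ℝ => (-(y n * Complex.I)) * ((bdryDensity m x : ℂ)
      * ((x : ℂ) - y n * Complex.I)⁻¹)) (Ioi 0) := fun n =>
    (integrableOn_bdryDensity_div hc hC (by simpa using hyp n)).const_mul _
  have hval : ∀ n, ∫ x in Ioi (0 : ℝ), bdryDensity m x * (y n ^ 2 / (x ^ 2 + y n ^ 2))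
      = (-(y n * Complex.I) * m (y n * Complex.I)).re := fun n => by
    have h1 := integral_re (hint n)
    simp only [RCLike.re_eq_complex_re, hre] at h1
    rw [h1, integral_const_mul, setIntegral_bdryDensity hc hd hC hneg (by simpa using hyp n)]
  have hint' : ∀ n, IntegrableOn
      (fun x : ℝ => bdryDensity m x * (y n ^ 2 / (x ^ 2 + y n ^ 2))) (Ioi 0) := fun n => by
    have h1 := (hint n).re
    simp only [RCLike.re_eq_complex_re, hre] at h1
    exact h1
  have hl1 : Tendsto (fun n => ENNReal.ofReal (-(y n * Complex.I) * m (y n * Complex.I)).re) atTop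
      (𝓝 1) := by
    have := ENNReal.tendsto_ofReal
      (((Complex.continuous_re.tendsto _).comp hlim).comp hyt)
    simpa [Function.comp_def] using this
  have hl2 : Tendsto (fun n => ∫⁻ x in Ioi (0 : ℝ),
      ENNReal.ofReal (bdryDensity m x * (y n ^ 2 / (x ^ 2 + y n ^ 2)))) atTop
      (𝓝 (∫⁻ x in Ioi (0 : ℝ), ENNReal.ofReal (bdryDensity m x))) := by
    refine lintegral_tendsto_of_tendsto_of_monotone (fun n => ?_) ?_ ?_
    · exact ((aemeasurable_bdryDensity hc).mul
        (Measurable.aemeasurable (by fun_prop))).ennreal_ofReal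
    · refine ae_restrict_of_forall_mem measurableSet_Ioi fun x hx => ?_
      intro n k hnk
      refine ENNReal.ofReal_le_ofReal (mul_le_mul_of_nonneg_left ?_ (hg x hx))
      have h1 : y n ≤ y k := by simp only [hy]; gcongr
      have h2 := hyp n
      have h3 := hyp k
      rw [div_le_div_iff₀ (by positivity) (by positivity)]
      have : y n ^ 2 ≤ y k ^ 2 := by gcongr
      nlinarith [sq_nonneg x]
    · refine ae_restrict_of_forall_mem measurableSet_Ioi fun x hx => ?_
      refine ENNReal.tendsto_ofReal ?_
      have h1 : Tendsto (fun n => y n ^ 2) atTop atTop := (tendsto_pow_atTop two_ne_zero).comp hyt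
      have h2 : Tendsto (fun n => x ^ 2 / (x ^ 2 + y n ^ 2)) atTop (𝓝 0) :=
        tendsto_const_nhds.div_atTop (tendsto_atTop_add_const_left _ _ h1)
      have h3 : Tendsto (fun n => bdryDensity m x * (1 - x ^ 2 / (x ^ 2 + y n ^ 2))) atTop
          (𝓝 (bdryDensity m x * (1 - 0))) := (h2.const_sub 1).const_mul _
      rw [sub_zero, mul_one] at h3
      refine h3.congr fun n => ?_
      have := hyp n
      have : 0 < x ^ 2 + y n ^ 2 := by positivity
      field_simp
      ring
  have heq : ∀ n, ∫⁻ x in Ioi (0 : ℝ),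
      ENNReal.ofReal (bdryDensity m x * (y n ^ 2 / (x ^ 2 + y n ^ 2)))
      = ENNReal.ofReal (-(y n * Complex.I) * m (y n * Complex.I)).re := fun n => by
    rw [← hval n, ofReal_integral_eq_lintegral_ofReal (hint' n)]
    refine ae_restrict_of_forall_mem measurableSet_Ioi fun x hx => ?_
    have := hg x hx
    have := hyp n
    positivity
  simp_rw [heq] at hl2
  refine ⟨?_⟩
  rw [bdryMeasure, withDensity_apply _ MeasurableSet.univ, Measure.restrict_univ]
  exact tendsto_nhds_unique hl2 hl1

end Density

end Canonical

end

/-! ### The transform `mFun` on the closed half-plane: continuity, sign and size. -/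

noncomputable section

namespace Canonical

open Bornology

variable {M : ℕ} {r : Fin M → ℝ} {c : ℝ} {p z : ℂ}

/-- Extension of `pInv` to the closed upper half-plane. -/
def pExt (c : ℝ) (r : Fin M → ℝ) : ℂ → ℂ := extendFrom uhp (pInv c r)

/-- The Stieltjes transform `(1/M) Tr T(z)`, extended to the closed upper half-plane. -/
def mFun (c : ℝ) (r : Fin M → ℝ) (z : ℂ) : ℂ := (kSum r (pExt c r z) - 1) / z

lemma cuhp_subset_closure : cuhp ⊆ closure uhp := by
  rw [Complex.closure_setOfPred_lt_im]

lemma pExt_spec (hM : 0 < M) (hr : ∀ i, 0 < r i) (hc : 0 < c) (hc1 : c ≤ 1) (hz : 0 ≤ z.im) :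
    (∀ i, (r i : ℂ) ≠ pExt c r z) ∧ phi c r (pExt c r z) = z ∧
      Tendsto (pInv c r) (𝓝[uhp] z) (𝓝 (pExt c r z)) := by
  obtain ⟨p, hp, hpz, ht⟩ : ∃ p : ℂ, (∀ i, (r i : ℂ) ≠ p) ∧ phi c r p = z ∧
      Tendsto (pInv c r) (𝓝[uhp] z) (𝓝 p) := by
    rcases hz.eq_or_lt with h | h
    · have hx : z = (z.re : ℂ) := by apply Complex.ext <;> simp [← h]
      rw [hx]
      exact exists_tendsto_pInv hM hr hc hc1 z.re
    · exact ⟨pInv c r z, dom_ne (pInv_mem hM hr hc hc1 h), phi_pInv hM hr hc hc1 h,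
        continuousOn_pInv hM hr hc hc1 z h⟩
  have : pExt c r z = p := extendFrom_eq (cuhp_subset_closure hz) ht
  rw [this]
  exact ⟨hp, hpz, ht⟩

lemma pExt_eq (hM : 0 < M) (hr : ∀ i, 0 < r i) (hc : 0 < c) (hc1 : c ≤ 1) (hz : 0 < z.im) :
    pExt c r z = pInv c r z :=
  extendFrom_extends (continuousOn_pInv hM hr hc hc1) z hz

lemma continuousOn_pExt (hM : 0 < M) (hr : ∀ i, 0 < r i) (hc : 0 < c) (hc1 : c ≤ 1) :
    ContinuousOn (pExt c r) cuhp :=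
  continuousOn_extendFrom cuhp_subset_closure fun _ hz => ⟨_, (pExt_spec hM hr hc hc1 hz).2.2⟩

lemma neBot_uhp (hz : 0 ≤ z.im) : (𝓝[uhp] z).NeBot :=
  mem_closure_iff_nhdsWithin_neBot.1 (cuhp_subset_closure hz)

lemma im_pExt_nonneg (hM : 0 < M) (hr : ∀ i, 0 < r i) (hc : 0 < c) (hc1 : c ≤ 1)
    (hz : 0 ≤ z.im) : 0 ≤ (pExt c r z).im := by
  have := neBot_uhp hz
  refine ge_of_tendsto ((Complex.continuous_im.tendsto _).comp (pExt_spec hM hr hc hc1 hz).2.2) ?_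
  filter_upwards [self_mem_nhdsWithin] with w hw using (pInv_mem hM hr hc hc1 hw).1.le

lemma pExt_zero (hM : 0 < M) (hr : ∀ i, 0 < r i) (hc : 0 < c) (hc1 : c ≤ 1) :
    pExt c r 0 = 0 :=
  extendFrom_eq (cuhp_subset_closure (by simp)) (tendsto_pInv_zero hM hr hc hc1)

lemma pExt_ne_zero (hM : 0 < M) (hr : ∀ i, 0 < r i) (hc : 0 < c) (hc1 : c ≤ 1)
    (hz : 0 ≤ z.im) (hz0 : z ≠ 0) : pExt c r z ≠ 0 := fun h => by
  have := (pExt_spec hM hr hc hc1 hz).2.1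
  rw [h, phi_zero] at this
  exact hz0 this.symm

lemma tendsto_pExt_zero (hM : 0 < M) (hr : ∀ i, 0 < r i) (hc : 0 < c) (hc1 : c ≤ 1) :
    Tendsto (pExt c r) (𝓝[cuhp] 0) (𝓝 0) := by
  have := (continuousOn_pExt hM hr hc hc1 0 (show 0 ≤ (0 : ℂ).im by simp)).tendsto
  rwa [pExt_zero hM hr hc hc1] at this

lemma tendsto_pExt_cobounded (hM : 0 < M) (hr : ∀ i, 0 < r i) (hc : 0 < c) (hc1 : c ≤ 1) :
    Tendsto (pExt c r) (cobounded ℂ ⊓ 𝓟 cuhp) (cobounded ℂ) := by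
  have h := tendsto_pInv_cobounded hM hr hc hc1
  rw [← tendsto_norm_atTop_iff_cobounded, tendsto_atTop] at h ⊢
  intro R
  have h1 := h R
  rw [eventually_inf_principal, ← comap_norm_atTop, eventually_comap, eventually_atTop] at h1 ⊢
  obtain ⟨N, hN⟩ := h1
  -- The extra unit ensures that points of the open half-plane close to `w` still have norm above
  -- `N`.
  refine ⟨N + 1, fun b hb w hw hwi => ?_⟩
  have hwi' : 0 ≤ w.im := hwi
  have := neBot_uhp hwi'
  refine ge_of_tendsto (pExt_spec hM hr hc hc1 hwi').2.2.norm ?_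
  have h2 : ∀ᶠ z in 𝓝[uhp] w, N < ‖z‖ :=
    (continuous_norm.continuousAt.eventually (lt_mem_nhds (by linarith))).filter_mono
      nhdsWithin_le_nhds
  filter_upwards [h2, self_mem_nhdsWithin] with z hz hz'
  exact hN ‖z‖ hz.le z rfl hz'

lemma continuousAt_kSum (hp : ∀ i, (r i : ℂ) ≠ p) : ContinuousAt (kSum r) p := by
  unfold kSum
  refine continuousAt_const.mul (tendsto_finsetSum _ fun i _ => ?_)
  exact ContinuousAt.div (by fun_prop) (by fun_prop) (sub_ne_zero.2 (hp i))

lemma continuousAt_gSum (hp : ∀ i, (r i : ℂ) ≠ p) : ContinuousAt (gSum r) p := by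
  unfold gSum
  refine continuousAt_const.mul (tendsto_finsetSum _ fun i _ => ?_)
  exact ContinuousAt.div (by fun_prop) (by fun_prop) (sub_ne_zero.2 (hp i))

lemma differentiableAt_kSum (hp : ∀ i, (r i : ℂ) ≠ p) : DifferentiableAt ℂ (kSum r) p := by
  unfold kSum
  refine DifferentiableAt.const_mul (DifferentiableAt.fun_sum fun i _ => ?_) _
  exact DifferentiableAt.div (by fun_prop) (by fun_prop) (sub_ne_zero.2 (hp i))

lemma continuousOn_mFun (hM : 0 < M) (hr : ∀ i, 0 < r i) (hc : 0 < c) (hc1 : c ≤ 1) :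
    ContinuousOn (mFun c r) (cuhp \ {0}) := by
  refine ContinuousOn.div ?_ continuousOn_id fun z hz => hz.2
  refine ContinuousOn.sub (fun z hz => ?_) continuousOn_const
  exact (continuousAt_kSum (pExt_spec hM hr hc hc1 hz.1).1).comp_continuousWithinAt
    ((continuousOn_pExt hM hr hc hc1).mono sdiff_subset z hz)

lemma differentiableOn_mFun (hM : 0 < M) (hr : ∀ i, 0 < r i) (hc : 0 < c) (hc1 : c ≤ 1) :
    DifferentiableOn ℂ (mFun c r) uhp := by
  have h : DifferentiableOn ℂ (fun z => (kSum r (pInv c r z) - 1) / z) uhp := fun z hz => by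
    refine DifferentiableAt.differentiableWithinAt ?_
    refine DifferentiableAt.div (DifferentiableAt.sub_const ?_ _) differentiableAt_id
      (ne_zero_of_im_pos hz)
    exact (differentiableAt_kSum (dom_ne (pInv_mem hM hr hc hc1 hz))).comp z
      (differentiableAt_pInv hM hr hc hc1 hz)
  exact h.congr fun z hz => by rw [mFun, pExt_eq hM hr hc hc1 hz]

lemma im_kSum (r : Fin M → ℝ) (p : ℂ) :
    (kSum r p).im = (M : ℝ)⁻¹ * ∑ i, r i * p.im / Complex.normSq (r i - p) := by
  rw [kSum, im_avg]
  congr 1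
  refine Finset.sum_congr rfl fun i _ => ?_
  rw [Complex.div_im]
  simp
  ring

lemma im_mFun_ofReal (x : ℝ) :
    (mFun c r x).im = (kSum r (pExt c r x)).im / x := by
  rw [mFun, Complex.div_ofReal_im, Complex.sub_im, Complex.one_im, sub_zero]

/-- In the limit `Im p ≥ 0` and `Im (-x / p) ≥ 0`; for `x < 0` the second inequality says `Im p ≤
0`, so `p` is real. -/
lemma im_mFun_of_neg (hM : 0 < M) (hr : ∀ i, 0 < r i) (hc : 0 < c) (hc1 : c ≤ 1) {x : ℝ}
    (hx : x < 0) : (mFun c r x).im = 0 := by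
  have hx0 : 0 ≤ ((x : ℂ)).im := by simp
  have h := pExt_spec hM hr hc hc1 hx0
  have hp0 := pExt_ne_zero hM hr hc hc1 hx0 (by exact_mod_cast hx.ne)
  have him := im_pExt_nonneg hM hr hc hc1 hx0
  have hne := neBot_uhp hx0
  have h1 : Tendsto (fun z => -z / pInv c r z) (𝓝[uhp] (x : ℂ)) (𝓝 (-x / pExt c r x)) :=
    (tendsto_id.mono_left nhdsWithin_le_nhds).neg.div h.2.2 hp0
  have h2 : 0 ≤ (-(x : ℂ) / pExt c r x).im := by
    refine ge_of_tendsto ((Complex.continuous_im.tendsto _).comp h1) ?_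
    filter_upwards [self_mem_nhdsWithin] with z hz
    have := (pInv_mem hM hr hc hc1 hz).2.2
    rw [phi_pInv hM hr hc hc1 hz] at this
    exact this.le
  have h3 : (-(x : ℂ) / pExt c r x).im = x * (pExt c r x).im / Complex.normSq (pExt c r x) := by
    rw [Complex.div_im]; simp; ring
  have h4 := Complex.normSq_pos.2 hp0
  rw [h3, le_div_iff₀ h4, zero_mul] at h2
  have h5 : (pExt c r x).im = 0 := by nlinarith
  rw [im_mFun_ofReal, im_kSum, h5]
  simp

lemma im_mFun_nonneg (hM : 0 < M) (hr : ∀ i, 0 < r i) (hc : 0 < c) (hc1 : c ≤ 1) {x : ℝ}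
    (hx : 0 < x) : 0 ≤ (mFun c r x).im := by
  have him := im_pExt_nonneg (z := x) hM hr hc hc1 (by simp)
  rw [im_mFun_ofReal, im_kSum]
  refine div_nonneg (mul_nonneg (by positivity) (Finset.sum_nonneg fun i _ => ?_)) hx.le
  exact div_nonneg (mul_nonneg (hr i).le him) (Complex.normSq_nonneg _)

/-- This form exhibits the cancellation in `k(p) - 1` near `p = 0`, leaving the regular factor
`gSum`. -/
lemma mFun_eq (hM : 0 < M) (hr : ∀ i, 0 < r i) (hc : 0 < c) (hc1 : c ≤ 1) (hz : 0 ≤ z.im) :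
    mFun c r z = pExt c r z * gSum r (pExt c r z) / z := by
  rw [mFun, kSum_eq hM (pExt_spec hM hr hc hc1 hz).1]; ring

lemma tendsto_mFun_I (hM : 0 < M) (hr : ∀ i, 0 < r i) (hc : 0 < c) (hc1 : c ≤ 1) :
    Tendsto (fun y : ℝ => -(y * Complex.I) * mFun c r (y * Complex.I)) atTop (𝓝 1) := by
  have h1 : Tendsto (fun y : ℝ => (y : ℂ) * Complex.I) atTop (cobounded ℂ ⊓ 𝓟 cuhp) := by
    refine tendsto_inf.2 ⟨?_, tendsto_principal.2 ?_⟩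
    · rw [← tendsto_norm_atTop_iff_cobounded]
      simpa using tendsto_abs_atTop_atTop
    · filter_upwards [eventually_ge_atTop 0] with y hy
      show 0 ≤ ((y : ℂ) * Complex.I).im
      simpa using hy
  have h2 := ((tendsto_kSum_cobounded r).comp
    ((tendsto_pExt_cobounded hM hr hc hc1).comp h1)).const_sub 1
  rw [sub_zero] at h2
  refine h2.congr' ?_
  filter_upwards [eventually_gt_atTop 0] with y hy
  have : (y : ℂ) * Complex.I ≠ 0 := mul_ne_zero (by exact_mod_cast hy.ne') Complex.I_ne_zero
  simp only [mFun, Function.comp_apply]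
  field_simp
  ring

/-- `(1/M) ∑ 1 / rᵢ`. -/
def invMean (r : Fin M → ℝ) : ℝ := (M : ℝ)⁻¹ * ∑ i, (r i)⁻¹

lemma invMean_pos (hM : 0 < M) (hr : ∀ i, 0 < r i) : 0 < invMean r := by
  have hne : Nonempty (Fin M) := ⟨⟨0, hM⟩⟩
  exact mul_pos (by positivity)
    (Finset.sum_pos (fun i _ => inv_pos.2 (hr i)) Finset.univ_nonempty)

lemma zero_ne (hr : ∀ i, 0 < r i) (i : Fin M) : (r i : ℂ) ≠ 0 := by
  exact_mod_cast (hr i).ne'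

lemma tendsto_kSum_zero (hM : 0 < M) (hr : ∀ i, 0 < r i) : Tendsto (kSum r) (𝓝 0) (𝓝 1) := by
  have := (continuousAt_kSum (zero_ne hr)).tendsto
  rwa [kSum_eq hM (zero_ne hr), zero_mul, add_zero] at this

lemma tendsto_gSum_zero (hr : ∀ i, 0 < r i) : Tendsto (gSum r) (𝓝 0) (𝓝 (invMean r : ℂ)) := by
  have := (continuousAt_gSum (zero_ne hr)).tendsto
  convert this using 2
  simp [gSum, invMean]

lemma phi_eq_of_lt (c : ℝ) (r : Fin M → ℝ) (p : ℂ) :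
    phi c r p = p ^ 2 * (-c * kSum r p * (1 - c * kSum r p)) := by
  rw [phi_eq]; ring

/-- For `c = 1` the factor `1 - c k` equals `-p G(p)` and vanishes at the origin, so the double zero
of `phi` becomes triple. This is where the exponent `2/3` originates. -/
lemma phi_one_eq (hM : 0 < M) (hp : ∀ i, (r i : ℂ) ≠ p) :
    phi 1 r p = p ^ 3 * (kSum r p * gSum r p) := by
  rw [phi_eq, Complex.ofReal_one]
  linear_combination (p ^ 2 * kSum r p) * kSum_eq hM hp

lemma tendsto_coeff_of_lt (hM : 0 < M) (hr : ∀ i, 0 < r i) (c : ℝ) :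
    Tendsto (fun p => -c * kSum r p * (1 - c * kSum r p)) (𝓝 0) (𝓝 (-(c * (1 - c) : ℝ))) := by
  have h := tendsto_kSum_zero hM hr
  have := (h.const_mul (-c : ℂ)).mul ((h.const_mul (c : ℂ)).const_sub 1)
  convert this using 2
  push_cast; ring

lemma tendsto_coeff_one (hM : 0 < M) (hr : ∀ i, 0 < r i) :
    Tendsto (fun p => kSum r p * gSum r p) (𝓝 0) (𝓝 (invMean r : ℂ)) := by
  simpa using (tendsto_kSum_zero hM hr).mul (tendsto_gSum_zero hr)

/-- The cubic bound is sharp for `c = 1`. For `c < 1` it is weaker than the quadratic one, but it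
allows one estimate to serve both cases. -/
lemma exists_phi_ge (hM : 0 < M) (hr : ∀ i, 0 < r i) (hc : 0 < c) (hc1 : c ≤ 1) :
    ∃ K > 0, ∀ᶠ p in 𝓝 (0 : ℂ), K * ‖p‖ ^ 3 ≤ ‖phi c r p‖ := by
  rcases hc1.lt_or_eq with h | rfl
  · have hpos : 0 < c * (1 - c) := mul_pos hc (by linarith)
    refine ⟨c * (1 - c) / 2, by positivity, ?_⟩
    have h1 := (tendsto_coeff_of_lt hM hr c).norm
    rw [norm_neg, Complex.norm_real, Real.norm_of_nonneg hpos.le] at h1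
    filter_upwards [h1.eventually (lt_mem_nhds (half_lt_self hpos)),
      Metric.ball_mem_nhds (0 : ℂ) one_pos] with p hp hp1
    rw [phi_eq_of_lt, norm_mul, norm_pow, mul_comm]
    have hp1' : ‖p‖ ≤ 1 := by simpa using (mem_ball_zero_iff.1 hp1).le
    have : ‖p‖ ^ 3 ≤ ‖p‖ ^ 2 := pow_le_pow_of_le_one (norm_nonneg _) hp1' (by norm_num)
    exact mul_le_mul this hp.le (by positivity) (by positivity)
  · have hpos := invMean_pos hM hr
    refine ⟨invMean r / 2, by positivity, ?_⟩
    have h1 := (tendsto_coeff_one hM hr).norm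
    rw [Complex.norm_real, Real.norm_of_nonneg hpos.le] at h1
    have h2 : ∀ᶠ p in 𝓝 (0 : ℂ), ∀ i, (r i : ℂ) ≠ p := by
      rw [eventually_all]
      exact fun i => (eventually_ne_nhds (zero_ne hr i).symm).mono fun p hp => hp.symm
    filter_upwards [h1.eventually (lt_mem_nhds (half_lt_self hpos)), h2] with p hp hp2
    rw [phi_one_eq hM hp2, norm_mul, norm_pow, mul_comm]
    gcongr

/-- `exists_phi_ge` gives `|p| = O(|z|^(1/3))`, and `m = p G(p) / z` with `G` bounded near zero. -/
lemma exists_bound_near_zero (hM : 0 < M) (hr : ∀ i, 0 < r i) (hc : 0 < c) (hc1 : c ≤ 1) :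
    ∃ A : ℝ, ∀ᶠ z in 𝓝[cuhp] (0 : ℂ), z ≠ 0 → ‖mFun c r z‖ ≤ A * ‖z‖ ^ (-(2 / 3) : ℝ) := by
  obtain ⟨K, hK, h1⟩ := exists_phi_ge hM hr hc hc1
  have h2 := (tendsto_gSum_zero hr).norm.eventually (gt_mem_nhds (lt_add_one _))
  set B := ‖(invMean r : ℂ)‖ + 1
  have hB : 0 < B := by positivity
  have ht := tendsto_pExt_zero hM hr hc hc1
  refine ⟨B * (K⁻¹) ^ (1 / 3 : ℝ), ?_⟩
  filter_upwards [ht.eventually h1, ht.eventually h2, self_mem_nhdsWithin] with z hz1 hz2 hz3 hz0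
  have hz3' : 0 ≤ z.im := hz3
  rw [(pExt_spec hM hr hc hc1 hz3').2.1] at hz1
  have hzp : 0 < ‖z‖ := norm_pos_iff.2 hz0
  have h4 : ‖pExt c r z‖ ≤ (K⁻¹) ^ (1 / 3 : ℝ) * ‖z‖ ^ (1 / 3 : ℝ) := by
    rw [← Real.mul_rpow (by positivity) (by positivity)]
    have : ‖pExt c r z‖ = (‖pExt c r z‖ ^ 3) ^ (1 / 3 : ℝ) := by
      rw [← Real.rpow_natCast, ← Real.rpow_mul (norm_nonneg _)]; norm_num
    rw [this]
    refine Real.rpow_le_rpow (by positivity) ?_ (by norm_num)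
    rw [inv_mul_eq_div, le_div_iff₀ hK]
    linarith
  rw [mFun_eq hM hr hc hc1 hz3', norm_div, norm_mul]
  have h5 : ‖z‖ ^ (-(2 / 3) : ℝ) = ‖z‖ ^ (1 / 3 : ℝ) / ‖z‖ := by
    rw [← Real.rpow_sub_one hzp.ne']; norm_num
  rw [h5, ← mul_div_assoc]
  refine div_le_div_of_nonneg_right ?_ hzp.le
  calc _ ≤ ((K⁻¹) ^ (1 / 3 : ℝ) * ‖z‖ ^ (1 / 3 : ℝ)) * B :=
        mul_le_mul h4 hz2.le (norm_nonneg _) (by positivity)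
    _ = _ := by ring

/-- Near zero by `exists_bound_near_zero`, on an intermediate region by compactness, and far away
because `k(p) → 0` gives `|m| ≤ 2 / |z|`. -/
lemma exists_bound (hM : 0 < M) (hr : ∀ i, 0 < r i) (hc : 0 < c) (hc1 : c ≤ 1) :
    ∃ A : ℝ, ∀ z : ℂ, 0 ≤ z.im → z ≠ 0 → ‖mFun c r z‖ ≤ A * ‖z‖ ^ (-(2 / 3) : ℝ) := by
  obtain ⟨A₁, h1⟩ := exists_bound_near_zero hM hr hc hc1
  obtain ⟨δ, hδ, h1⟩ := Metric.mem_nhdsWithin_iff.1 h1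
  have h2 : ∀ᶠ z in cobounded ℂ ⊓ 𝓟 cuhp, ‖kSum r (pExt c r z)‖ < 1 :=
    ((tendsto_kSum_cobounded r).comp (tendsto_pExt_cobounded hM hr hc hc1)).norm.eventually
      (gt_mem_nhds (by simp))
  rw [eventually_inf_principal, ← comap_norm_atTop, eventually_comap, eventually_atTop] at h2
  obtain ⟨N, hN⟩ := h2
  set N' := max N 1
  have hcomp : IsCompact (Metric.closedBall (0 : ℂ) N' ∩ (cuhp ∩ (Metric.ball (0 : ℂ) δ)ᶜ)) :=
    (isCompact_closedBall _ _).inter_right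
      ((isClosed_le continuous_const Complex.continuous_im).inter Metric.isOpen_ball.isClosed_compl)
  obtain ⟨B, hB⟩ := hcomp.exists_bound_of_continuousOn
    ((continuousOn_mFun hM hr hc hc1).mono fun z hz => ⟨hz.2.1, fun h => hz.2.2 (by
      rw [mem_singleton_iff.1 h]; exact Metric.mem_ball_self hδ)⟩)
  refine ⟨max A₁ (max 2 (B / N' ^ (-(2 / 3) : ℝ))), fun z hz hz0 => ?_⟩
  have hzp : 0 < ‖z‖ := norm_pos_iff.2 hz0
  have hN'p : 0 < N' := lt_of_lt_of_le one_pos (le_max_right _ _)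
  by_cases hz1 : z ∈ Metric.ball (0 : ℂ) δ
  · refine (h1 ⟨hz1, hz⟩ hz0).trans ?_
    gcongr
    exact le_max_left _ _
  by_cases hz2 : ‖z‖ ≤ N'
  · refine (hB z ⟨mem_closedBall_zero_iff.2 hz2, hz, hz1⟩).trans ?_
    have h3 : N' ^ (-(2 / 3) : ℝ) ≤ ‖z‖ ^ (-(2 / 3) : ℝ) :=
      Real.rpow_le_rpow_of_nonpos hzp hz2 (by norm_num)
    have h4 : 0 < N' ^ (-(2 / 3) : ℝ) := by positivity
    have h5 : B / N' ^ (-(2 / 3) : ℝ) ≤ max A₁ (max 2 (B / N' ^ (-(2 / 3) : ℝ))) :=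
      (le_max_right _ _).trans (le_max_right _ _)
    have h6 : 0 ≤ max A₁ (max 2 (B / N' ^ (-(2 / 3) : ℝ))) :=
      le_trans (by norm_num : (0 : ℝ) ≤ 2) ((le_max_left _ _).trans (le_max_right _ _))
    calc B = B / N' ^ (-(2 / 3) : ℝ) * N' ^ (-(2 / 3) : ℝ) := by field_simp
      _ ≤ _ := mul_le_mul h5 h3 h4.le h6
  · push Not at hz2
    have hz3 : N ≤ ‖z‖ := (le_max_left _ _).trans hz2.le
    have hz4 : 1 ≤ ‖z‖ := (le_max_right _ _).trans hz2.le
    have h3 := hN ‖z‖ hz3 z rfl hz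
    have h4 : ‖kSum r (pExt c r z) - 1‖ ≤ 2 := by
      refine (norm_sub_le _ _).trans ?_
      rw [norm_one]; linarith
    have h5 : ‖z‖⁻¹ ≤ ‖z‖ ^ (-(2 / 3) : ℝ) := by
      rw [← Real.rpow_neg_one]
      exact Real.rpow_le_rpow_of_exponent_le hz4 (by norm_num)
    rw [mFun, norm_div, div_eq_mul_inv]
    have h6 : (2 : ℝ) ≤ max A₁ (max 2 (B / N' ^ (-(2 / 3) : ℝ))) :=
      (le_max_left _ _).trans (le_max_right _ _)
    exact mul_le_mul (h4.trans h6) h5 (by positivity) (by linarith)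

end Canonical

end

/-! ### Asymptotics of the density at the origin. -/

noncomputable section

namespace Canonical

variable {M : ℕ} {r : Fin M → ℝ} {c : ℝ} {p z : ℂ}

/-- The square root in the upper half-plane is continuous at negative reals. -/
lemma tendsto_of_sq {α : Type*} {l : Filter α} {w : α → ℂ} {a : ℝ} (ha : 0 < a)
    (h : Tendsto (fun x => w x ^ 2) l (𝓝 (-(a ^ 2 : ℝ)))) (him : ∀ᶠ x in l, 0 ≤ (w x).im) :
    Tendsto w l (𝓝 (a * Complex.I)) := by
  rw [tendsto_iff_norm_sub_tendsto_zero] at h ⊢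
  have h2 := h.const_mul a⁻¹
  rw [mul_zero] at h2
  refine squeeze_zero' (Eventually.of_forall fun _ => norm_nonneg _) ?_ h2
  filter_upwards [him] with x hx
  -- The factor at the opposite root is bounded below by `a` in the upper half-plane, so convergence
  -- of squares controls the distance to `i a`.
  have h3 : w x ^ 2 - (-(a ^ 2 : ℝ)) = (w x - a * Complex.I) * (w x + a * Complex.I) := by
    push_cast
    linear_combination ((a : ℂ) ^ 2) * Complex.I_sq
  have h4 : a ≤ ‖w x + a * Complex.I‖ := by
    refine le_trans ?_ (Complex.abs_im_le_norm _)
    simp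
    rw [abs_of_nonneg (by linarith)]
    linarith
  rw [h3, norm_mul, inv_mul_eq_div, le_div_iff₀ ha]
  gcongr

/-- The cube root in the second quadrant is continuous at positive reals. -/
lemma tendsto_of_cube {α : Type*} {l : Filter α} {w : α → ℂ} {b : ℝ} (hb : 0 < b)
    (h : Tendsto (fun x => w x ^ 3) l (𝓝 ((b ^ 3 : ℝ) : ℂ))) (him : ∀ᶠ x in l, 0 ≤ (w x).im)
    (hre : ∀ᶠ x in l, (w x).re ≤ 0) :
    Tendsto w l (𝓝 (b * (-(1 / 2) + (Real.sqrt 3 / 2 : ℝ) * Complex.I))) := by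
  rw [tendsto_iff_norm_sub_tendsto_zero] at h ⊢
  have h2 := h.const_mul (2 / b ^ 2)
  rw [mul_zero] at h2
  refine squeeze_zero' (Eventually.of_forall fun _ => norm_nonneg _) ?_ h2
  filter_upwards [him, hre] with x hx hx'
  have hs : Real.sqrt 3 ^ 2 = 3 := Real.sq_sqrt (by norm_num)
  have hs1 : 1 ≤ Real.sqrt 3 := by rw [Real.one_le_sqrt]; norm_num
  have hsc : ((Real.sqrt 3 : ℝ) : ℂ) ^ 2 = 3 := by exact_mod_cast hs
  have h3 : w x ^ 3 - (b ^ 3 : ℝ) = (w x - b * (-(1 / 2) + (Real.sqrt 3 / 2 : ℝ) * Complex.I)) *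
      ((w x - b) * (w x - b * (-(1 / 2) - (Real.sqrt 3 / 2 : ℝ) * Complex.I))) := by
    push_cast
    linear_combination ((w x - b) * b ^ 2 * (Real.sqrt 3 : ℂ) ^ 2 / 4) * Complex.I_sq
      - ((w x - b) * b ^ 2 / 4) * hsc
  -- Each of the other two cube roots is at a definite distance: `b` is excluded by `Re w ≤ 0`, the
  -- conjugate root by `Im w ≥ 0`.
  have h4 : b ≤ ‖w x - b‖ := by
    refine le_trans ?_ (Complex.abs_re_le_norm _)
    rw [Complex.sub_re, Complex.ofReal_re, abs_of_nonpos (by linarith)]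
    linarith
  have h5 : b / 2 ≤ ‖w x - b * (-(1 / 2) - (Real.sqrt 3 / 2 : ℝ) * Complex.I)‖ := by
    refine le_trans ?_ (Complex.abs_im_le_norm _)
    refine le_trans ?_ (le_abs_self _)
    rw [Complex.sub_im, Complex.im_ofReal_mul, Complex.sub_im, Complex.im_ofReal_mul]
    simp
    nlinarith
  rw [h3, norm_mul, norm_mul, div_mul_eq_mul_div, le_div_iff₀ (by positivity)]
  have h6 : b * (b / 2) ≤ ‖w x - b‖ *
      ‖w x - b * (-(1 / 2) - (Real.sqrt 3 / 2 : ℝ) * Complex.I)‖ := by gcongr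
  nlinarith [norm_nonneg (w x - b * (-(1 / 2) + (Real.sqrt 3 / 2 : ℝ) * Complex.I))]

lemma tendsto_ofReal_right : Tendsto (fun x : ℝ => (x : ℂ)) (𝓝[>] 0) (𝓝[cuhp] 0) := by
  refine tendsto_nhdsWithin_iff.2 ⟨?_, Eventually.of_forall fun x => ?_⟩
  · simpa using (Complex.continuous_ofReal.tendsto 0).mono_left nhdsWithin_le_nhds
  · show 0 ≤ (x : ℂ).im
    simp

lemma tendsto_pExt_right (hM : 0 < M) (hr : ∀ i, 0 < r i) (hc : 0 < c) (hc1 : c ≤ 1) :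
    Tendsto (fun x : ℝ => pExt c r x) (𝓝[>] 0) (𝓝 0) :=
  (tendsto_pExt_zero hM hr hc hc1).comp tendsto_ofReal_right

/-- Scaling limit of the density from that of `pExt`. -/
lemma tendsto_mul_bdryDensity (hM : 0 < M) (hr : ∀ i, 0 < r i) (hc : 0 < c) (hc1 : c ≤ 1)
    {u : ℝ → ℝ} (hu : ∀ x, 0 < x → 0 < u x) {L : ℂ}
    (h : Tendsto (fun x : ℝ => pExt c r x / (u x : ℂ)) (𝓝[>] 0) (𝓝 L)) :
    Tendsto (fun x : ℝ => x / u x * bdryDensity (mFun c r) x) (𝓝[>] 0)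
      (𝓝 (L.im * invMean r / Real.pi)) := by
  have h1 := h.mul ((tendsto_gSum_zero hr).comp (tendsto_pExt_right hM hr hc hc1))
  have h2 := ((Complex.continuous_im.tendsto _).comp h1).div_const Real.pi
  rw [Complex.im_mul_ofReal] at h2
  refine h2.congr' ?_
  filter_upwards [self_mem_nhdsWithin] with x hx
  have hx' : (0 : ℝ) < x := hx
  have hux := hu x hx'
  have e : pExt c r x / (u x : ℂ) * gSum r (pExt c r x) = ((x / u x : ℝ) : ℂ) * mFun c r x := by
    rw [mFun_eq hM hr hc hc1 (by simp)]
    have : (x : ℂ) ≠ 0 := by exact_mod_cast hx'.ne'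
    push_cast
    field_simp
  simp only [Function.comp_apply, bdryDensity]
  rw [e, Complex.im_ofReal_mul]
  ring

lemma tendsto_pExt_div_sqrt (hM : 0 < M) (hr : ∀ i, 0 < r i) (hc : 0 < c) (hc1 : c < 1) :
    Tendsto (fun x : ℝ => pExt c r x / (Real.sqrt x : ℂ)) (𝓝[>] 0)
      (𝓝 ((1 / Real.sqrt (c * (1 - c)) : ℝ) * Complex.I)) := by
  have hpos : 0 < c * (1 - c) := mul_pos hc (by linarith)
  refine tendsto_of_sq (by positivity) ?_ ?_
  · have h1 := ((tendsto_coeff_of_lt hM hr c).comp (tendsto_pExt_right hM hr hc hc1.le)).inv₀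
      (neg_ne_zero.2 (by exact_mod_cast hpos.ne'))
    have e : (-((c * (1 - c) : ℝ) : ℂ))⁻¹ = -(((1 / Real.sqrt (c * (1 - c))) ^ 2 : ℝ) : ℂ) := by
      rw [div_pow, Real.sq_sqrt hpos.le]
      push_cast
      rw [inv_neg, one_pow, one_div]
    rw [e] at h1
    refine h1.congr' ?_
    filter_upwards [self_mem_nhdsWithin] with x hx
    have hx' : (0 : ℝ) < x := hx
    have h2 := (pExt_spec (z := x) hM hr hc hc1.le (by simp)).2.1
    rw [phi_eq_of_lt] at h2
    have h3 : (Real.sqrt x : ℂ) ^ 2 = x := by exact_mod_cast Real.sq_sqrt hx'.le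
    have hx0 : (x : ℂ) ≠ 0 := by exact_mod_cast hx'.ne'
    simp only [Function.comp_apply]
    have h4 : -c * kSum r (pExt c r x) * (1 - c * kSum r (pExt c r x)) ≠ 0 := by
      intro h0
      rw [h0, mul_zero] at h2
      exact hx0 h2.symm
    rw [div_pow, h3, eq_div_iff hx0, inv_mul_eq_iff_eq_mul₀ h4, mul_comm, h2]
  · filter_upwards [self_mem_nhdsWithin] with x hx
    rw [Complex.div_ofReal_im]
    exact div_nonneg (im_pExt_nonneg hM hr hc hc1.le (by simp)) (Real.sqrt_nonneg _)

/-- Near the origin, `pInv` lies in the left half-plane when `c = 1`. -/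
lemma re_pInv_neg_near_zero (hM : 0 < M) (hr : ∀ i, 0 < r i) :
    ∃ δ > 0, ∀ z : ℂ, 0 < z.im → ‖z‖ < δ → (pInv 1 r z).re < 0 := by
  have hc : (0 : ℝ) < 1 := one_pos
  have h1 := (Complex.continuous_re.tendsto _).comp (tendsto_coeff_one hM hr)
  rw [Complex.ofReal_re] at h1
  have h2 := (tendsto_pInv_zero hM hr hc le_rfl).eventually
    (h1.eventually (lt_mem_nhds (invMean_pos hM hr)))
  obtain ⟨δ, hδ, hsub⟩ := Metric.mem_nhdsWithin_iff.1 h2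
  refine ⟨δ, hδ, fun z hz hzδ => ?_⟩
  set S := Metric.ball (0 : ℂ) δ ∩ uhp
  have hpre : IsPreconnected S := ((convex_ball _ _).inter (convex_halfSpace_im_gt 0)).isPreconnected
  have hcont : ContinuousOn (fun z => (pInv 1 r z).re) S :=
    Complex.continuous_re.comp_continuousOn
      ((continuousOn_pInv hM hr hc le_rfl).mono inter_subset_right)
  by_contra! hcon
  have hzS : z ∈ S := ⟨mem_ball_zero_iff.2 hzδ, hz⟩
  set w : ℂ := ((δ / 2 : ℝ) : ℂ) * Complex.I with hw
  have hwim : 0 < w.im := by simp [hw, hδ]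
  have hwS : w ∈ S := by
    refine ⟨mem_ball_zero_iff.2 ?_, hwim⟩
    rw [hw, norm_mul, Complex.norm_I, mul_one, Complex.norm_real,
      Real.norm_of_nonneg (by positivity)]
    linarith
  have hwre : (pInv 1 r w).re < 0 := re_pInv_neg hM hr hc le_rfl hwim (by simp [hw])
  -- Since `Re p < 0` on the imaginary axis, a change of sign in the half-disc would produce a point
  -- with `p = i s`, `s > 0`. There `y = -i s³ k G` with `Re (k G) > 0`, so `Im y < 0`, a
  -- contradiction.
  obtain ⟨y, hy, hy0⟩ := hpre.intermediate_value hwS hzS hcont ⟨hwre.le, hcon⟩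
  have hp := pInv_mem hM hr hc le_rfl hy.2
  have h3 := phi_pInv hM hr hc le_rfl hy.2
  have h4 : 0 < (kSum r (pInv 1 r y) * gSum r (pInv 1 r y)).re := hsub hy
  have h5 : pInv 1 r y = ((pInv 1 r y).im : ℂ) * Complex.I := by
    apply Complex.ext
    · simpa using hy0
    · simp
  rw [phi_one_eq hM (dom_ne hp)] at h3
  have h6 : pInv 1 r y ^ 3 = ((-(pInv 1 r y).im ^ 3 : ℝ) : ℂ) * Complex.I := by
    conv_lhs => rw [h5]
    push_cast
    linear_combination (((pInv 1 r y).im : ℂ) ^ 3 * Complex.I) * Complex.I_sq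
  rw [h6, mul_assoc] at h3
  have h7 := congrArg Complex.im h3
  rw [Complex.im_ofReal_mul, Complex.I_mul_im] at h7
  have h8 : 0 < y.im := hy.2
  have h9 : 0 < (pInv 1 r y).im ^ 3 := pow_pos hp.1 3
  nlinarith [mul_pos h9 h4]

lemma tendsto_pExt_div_cbrt (hM : 0 < M) (hr : ∀ i, 0 < r i) :
    Tendsto (fun x : ℝ => pExt 1 r x / ((x ^ (1 / 3 : ℝ) : ℝ) : ℂ)) (𝓝[>] 0)
      (𝓝 ((invMean r ^ (-(1 / 3) : ℝ) : ℝ) *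
        (-(1 / 2) + (Real.sqrt 3 / 2 : ℝ) * Complex.I))) := by
  have hc : (0 : ℝ) < 1 := one_pos
  have hpos := invMean_pos hM hr
  refine tendsto_of_cube (by positivity) ?_ ?_ ?_
  · have h1 := ((tendsto_coeff_one hM hr).comp (tendsto_pExt_right hM hr hc le_rfl)).inv₀
      (by exact_mod_cast hpos.ne')
    have e : ((invMean r : ℝ) : ℂ)⁻¹ = (((invMean r ^ (-(1 / 3) : ℝ)) ^ 3 : ℝ) : ℂ) := by
      rw [← Complex.ofReal_inv, ← Real.rpow_natCast, ← Real.rpow_mul hpos.le, ← Real.rpow_neg_one]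
      norm_num
    rw [e] at h1
    refine h1.congr' ?_
    filter_upwards [self_mem_nhdsWithin] with x hx
    have hx' : (0 : ℝ) < x := hx
    have hs := pExt_spec (z := x) hM hr hc le_rfl (by simp)
    have h2 := hs.2.1
    rw [phi_one_eq hM hs.1] at h2
    have h3 : ((x ^ (1 / 3 : ℝ) : ℝ) : ℂ) ^ 3 = x := by
      rw [← Complex.ofReal_pow, ← Real.rpow_natCast, ← Real.rpow_mul hx'.le]
      norm_num
    have hx0 : (x : ℂ) ≠ 0 := by exact_mod_cast hx'.ne'
    simp only [Function.comp_apply]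
    have h4 : kSum r (pExt 1 r x) * gSum r (pExt 1 r x) ≠ 0 := by
      intro h0
      rw [h0, mul_zero] at h2
      exact hx0 h2.symm
    rw [div_pow, h3, eq_div_iff hx0, inv_mul_eq_iff_eq_mul₀ h4, mul_comm, h2]
  · filter_upwards [self_mem_nhdsWithin] with x hx
    have hx' : (0 : ℝ) < x := hx
    rw [Complex.div_ofReal_im]
    exact div_nonneg (im_pExt_nonneg hM hr hc le_rfl (by simp)) (by positivity)
  · obtain ⟨δ, hδ, h⟩ := re_pInv_neg_near_zero hM hr
    filter_upwards [Ioo_mem_nhdsGT hδ] with x hx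
    rw [Complex.div_ofReal_re]
    refine div_nonpos_of_nonpos_of_nonneg ?_ (Real.rpow_nonneg hx.1.le _)
    have hx0 : 0 ≤ ((x : ℂ)).im := by simp
    have := neBot_uhp hx0
    refine le_of_tendsto ((Complex.continuous_re.tendsto _).comp
      (pExt_spec hM hr hc le_rfl hx0).2.2) ?_
    have h2 : ∀ᶠ z in 𝓝[uhp] (x : ℂ), ‖z‖ < δ :=
      (continuous_norm.continuousAt.eventually (gt_mem_nhds (by
        show ‖(x : ℂ)‖ < δ
        rw [Complex.norm_real, Real.norm_of_nonneg hx.1.le]; exact hx.2))).filter_mono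
        nhdsWithin_le_nhds
    filter_upwards [h2, self_mem_nhdsWithin] with z hz hz'
    exact (h z hz' hz).le

/-- From a scaling limit to an equivalent and divergence. -/
lemma isEquivalent_of_tendsto_mul {g s : ℝ → ℝ} {L : ℝ} (hL : 0 < L) (hs : ∀ x, 0 < x → 0 < s x)
    (hs0 : Tendsto s (𝓝[>] 0) (𝓝 0)) (h : Tendsto (fun x => s x * g x) (𝓝[>] 0) (𝓝 L)) :
    Asymptotics.IsEquivalent (𝓝[>] 0) g (fun x => L * (1 / s x)) ∧ Tendsto g (𝓝[>] 0) atTop := by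
  have hE : Asymptotics.IsEquivalent (𝓝[>] 0) g (fun x => L * (1 / s x)) := by
    refine Asymptotics.isEquivalent_of_tendsto_one ?_
    have := h.div_const L
    rw [div_self hL.ne'] at this
    refine this.congr' ?_
    filter_upwards [self_mem_nhdsWithin] with x hx
    have := hs x hx
    simp only [Pi.div_apply]
    field_simp
  refine ⟨hE, hE.symm.tendsto_atTop ?_⟩
  refine Tendsto.const_mul_atTop hL ?_
  simp only [one_div]
  refine Tendsto.inv_tendsto_nhdsGT_zero (tendsto_nhdsWithin_iff.2 ⟨hs0, ?_⟩)
  filter_upwards [self_mem_nhdsWithin] with x hx using hs x hx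

lemma density_of_lt (hM : 0 < M) (hr : ∀ i, 0 < r i) (hc : 0 < c) (hc1 : c < 1) :
    Asymptotics.IsEquivalent (𝓝[>] 0) (bdryDensity (mFun c r)) (fun x : ℝ =>
        (1 / Real.pi) * (1 / Real.sqrt (c * (1 - c))) * invMean r * (1 / Real.sqrt x)) ∧
      Tendsto (bdryDensity (mFun c r)) (𝓝[>] 0) atTop := by
  have hpos : 0 < c * (1 - c) := mul_pos hc (by linarith)
  have hi := invMean_pos hM hr
  have h1 := tendsto_mul_bdryDensity hM hr hc hc1.le (fun x hx => Real.sqrt_pos.2 hx)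
    (tendsto_pExt_div_sqrt hM hr hc hc1)
  refine isEquivalent_of_tendsto_mul (by positivity) (fun x hx => Real.sqrt_pos.2 hx) ?_ ?_
  · simpa using (Real.continuous_sqrt.tendsto 0).mono_left nhdsWithin_le_nhds
  · convert h1 using 2
    · rename_i x
      rw [Real.div_sqrt]
    · rw [Complex.im_ofReal_mul, Complex.I_im]; ring

lemma density_of_eq_one (hM : 0 < M) (hr : ∀ i, 0 < r i) :
    Asymptotics.IsEquivalent (𝓝[>] 0) (bdryDensity (mFun 1 r)) (fun x : ℝ =>
        (1 / Real.pi) * (Real.sqrt 3 / 2) * invMean r ^ (2 / 3 : ℝ) * (1 / x ^ (2 / 3 : ℝ))) ∧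
      Tendsto (bdryDensity (mFun 1 r)) (𝓝[>] 0) atTop := by
  have hi := invMean_pos hM hr
  have h1 := tendsto_mul_bdryDensity hM hr one_pos le_rfl
    (fun x hx => Real.rpow_pos_of_pos hx (1 / 3 : ℝ)) (tendsto_pExt_div_cbrt hM hr)
  refine isEquivalent_of_tendsto_mul (by positivity) (fun x hx => Real.rpow_pos_of_pos hx _) ?_ ?_
  · have h2 : ContinuousAt (fun x : ℝ => x ^ (2 / 3 : ℝ)) 0 :=
      Real.continuousAt_rpow_const _ _ (Or.inr (by norm_num))
    have h3 := h2.tendsto.mono_left (nhdsWithin_le_nhds (s := Ioi 0))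
    rwa [Real.zero_rpow (by norm_num)] at h3
  · have e : (((invMean r ^ (-(1 / 3) : ℝ) : ℝ) : ℂ) *
        (-(1 / 2) + (Real.sqrt 3 / 2 : ℝ) * Complex.I)).im * invMean r / Real.pi
        = (1 / Real.pi) * (Real.sqrt 3 / 2) * invMean r ^ (2 / 3 : ℝ) := by
      have : invMean r ^ (2 / 3 : ℝ) = invMean r ^ (-(1 / 3) : ℝ) * invMean r := by
        rw [← Real.rpow_add_one hi.ne']; norm_num
      rw [this, Complex.im_ofReal_mul, Complex.add_im, Complex.im_ofReal_mul, Complex.I_im]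
      simp
      ring
    rw [e] at h1
    refine h1.congr' ?_
    filter_upwards [self_mem_nhdsWithin] with x hx
    have hx' : (0 : ℝ) < x := hx
    have : x ^ (2 / 3 : ℝ) = x / x ^ (1 / 3 : ℝ) := by
      rw [eq_div_iff (by positivity), ← Real.rpow_add hx']; norm_num
    rw [this]

end Canonical

end

/-! ### From the matrix equation to the eigenvalues and back. -/

noncomputable section

namespace Canonical

variable {M : ℕ} {c : ℝ} {z t : ℂ} {R : Matrix (Fin M) (Fin M) ℂ}

open Unitary in
lemma trace_conjStarAlgAut (U : unitary (Matrix (Fin M) (Fin M) ℂ))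
    (X : Matrix (Fin M) (Fin M) ℂ) : (conjStarAlgAut ℂ _ U X).trace = X.trace := by
  rw [conjStarAlgAut_apply, Matrix.trace_mul_comm, ← mul_assoc]
  simp

open Unitary in
/-- Functional calculus for the inverse of an affine function of a Hermitian matrix. -/
lemma inv_affine (hR : R.IsHermitian) {a b : ℂ} (h : ∀ i, a - b * hR.eigenvalues i ≠ 0) :
    (a • (1 : Matrix (Fin M) (Fin M) ℂ) - b • R)⁻¹ = conjStarAlgAut ℂ _ hR.eigenvectorUnitary
      (Matrix.diagonal fun i => (a - b * hR.eigenvalues i)⁻¹) := by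
  refine Matrix.inv_eq_right_inv ?_
  have h1 : a • (1 : Matrix (Fin M) (Fin M) ℂ) - b • R
      = conjStarAlgAut ℂ _ hR.eigenvectorUnitary
        (Matrix.diagonal fun i => a - b * hR.eigenvalues i) := by
    have h2 : (Matrix.diagonal fun i => a - b * (hR.eigenvalues i : ℂ))
        = a • (1 : Matrix (Fin M) (Fin M) ℂ)
          - b • Matrix.diagonal (RCLike.ofReal ∘ hR.eigenvalues) := by
      ext i j
      by_cases hij : i = j
      · subst hij; simp
      · simp [hij]
    rw [h2, map_sub, map_smul, map_smul, map_one, ← hR.spectral_theorem]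
  rw [h1, ← map_mul, Matrix.diagonal_mul_diagonal]
  simp only [mul_inv_cancel₀ (h _), Matrix.diagonal_one, map_one]

open Unitary in
lemma trace_inv_affine (hR : R.IsHermitian) {a b : ℂ} (h : ∀ i, a - b * hR.eigenvalues i ≠ 0) :
    ((a • (1 : Matrix (Fin M) (Fin M) ℂ) - b • R)⁻¹).trace
      = ∑ i, (a - b * hR.eigenvalues i)⁻¹ := by
  rw [inv_affine hR h, trace_conjStarAlgAut, Matrix.trace_diagonal]

open Unitary in
lemma trace_mul_inv_affine (hR : R.IsHermitian) {a b : ℂ}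
    (h : ∀ i, a - b * hR.eigenvalues i ≠ 0) :
    (R * (a • (1 : Matrix (Fin M) (Fin M) ℂ) - b • R)⁻¹).trace
      = ∑ i, (hR.eigenvalues i : ℂ) / (a - b * hR.eigenvalues i) := by
  rw [inv_affine hR h]
  conv_lhs => enter [1, 1]; rw [hR.spectral_theorem]
  rw [← map_mul, trace_conjStarAlgAut, Matrix.diagonal_mul_diagonal, Matrix.trace_diagonal]
  exact Finset.sum_congr rfl fun i _ => by simp [div_eq_mul_inv]

lemma normalizedTraceInv_eq (hR : R.PosDef) :
    normalizedTraceInv R = invMean hR.1.eigenvalues := by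
  have h := trace_inv_affine hR.1 (a := 0) (b := -1) fun i => by
    have := hR.eigenvalues_pos i
    simpa using this.ne'
  simp only [zero_smul, neg_smul, one_smul, sub_neg_eq_add, zero_add, neg_mul, one_mul] at h
  rw [normalizedTraceInv, h, invMean, Complex.re_sum, one_div]
  congr 1
  refine Finset.sum_congr rfl fun i _ => ?_
  rw [← Complex.ofReal_inv, Complex.ofReal_re]

lemma resolventMatrix_eq (c : ℝ) (R : Matrix (Fin M) (Fin M) ℂ) (z t : ℂ) :
    resolventMatrix c R z t = ((-z) • (1 : Matrix (Fin M) (Fin M) ℂ)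
      - ((z * c * t) / (1 - z * c ^ 2 * t ^ 2)) • R)⁻¹ := by
  rw [resolventMatrix, neg_smul]

/-- Inverting makes the formula valid even if `1 - z c² t²` vanishes, both sides then being zero. -/
lemma inv_coeff (hc : c ≠ 0) (hz : z ≠ 0) (ht : t ≠ 0) :
    ((z * c * t) / (1 - z * c ^ 2 * t ^ 2))⁻¹ = (c * (z * t))⁻¹ - c * t := by
  have hc' : (c : ℂ) ≠ 0 := by exact_mod_cast hc
  rw [inv_div]
  field_simp

/-- A point of the domain gives a canonical solution. -/
lemma isCanonicalSolution_of_mem_dom (hM : 0 < M) (hR : R.PosDef) (hc : 0 < c) {p : ℂ}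
    (hp : p ∈ dom c hR.1.eigenvalues) (hpz : phi c hR.1.eigenvalues p = z) :
    IsCanonicalSolution c R z (qSum hR.1.eigenvalues p / z) ∧
      (1 / (M : ℂ)) * (resolventMatrix c R z (qSum hR.1.eigenvalues p / z)).trace
        = p * gSum hR.1.eigenvalues p / z := by
  have hr := hR.eigenvalues_pos
  have hz : 0 < z.im := hpz ▸ hp.2.1
  have hz0 := ne_zero_of_im_pos hz
  have hp0 := ne_zero_of_im_pos hp.1
  have hpi := dom_ne hp
  have hq0 := qSum_ne_zero hz0 hpz
  have ht := im_qSum_div_pos hM hr hpi hp0 hz (by have := hp.2.2.le; rwa [hpz] at this)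
  have hzt : z * (qSum hR.1.eigenvalues p / z) = qSum hR.1.eigenvalues p := by field_simp
  have hk : (z * c * (qSum hR.1.eigenvalues p / z))
      / (1 - z * c ^ 2 * (qSum hR.1.eigenvalues p / z) ^ 2) = -z / p := by
    apply inv_injective
    rw [inv_coeff hc.ne' hz0 (div_ne_zero hq0 hz0), inv_neg_div hc.ne' hz0 hpz, hzt]
  have hne : ∀ i, -z - (-z / p) * (hR.1.eigenvalues i : ℂ) ≠ 0 := fun i => by
    rw [div_sub_eq hp0]
    exact div_ne_zero (mul_ne_zero hz0 (sub_ne_zero.2 (hpi i))) hp0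
  refine ⟨⟨ht, ?_, ?_⟩, ?_⟩
  · rw [hzt, im_qSum]
    exact mul_pos (kappa_pos hM hr hpi) hp.1
  · rw [resolventMatrix_eq, hk, trace_mul_inv_affine hR.1 hne, one_div,
      ← qSum_div_eq hpi hp0 hz0]
  · rw [resolventMatrix_eq, hk, trace_inv_affine hR.1 hne, one_div, gSum, mul_left_comm,
      mul_div_assoc]
    congr 1
    rw [Finset.mul_sum, Finset.sum_div]
    refine Finset.sum_congr rfl fun i _ => ?_
    rw [div_sub_eq hp0, inv_div]
    have := sub_ne_zero.2 (hpi i)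
    field_simp

/-- A canonical solution comes from a point of the domain. -/
lemma exists_mem_dom_of_isCanonicalSolution (hR : R.PosDef) (hc : 0 < c)
    (hz : 0 < z.im) (h : IsCanonicalSolution c R z t) :
    ∃ p ∈ dom c hR.1.eigenvalues, phi c hR.1.eigenvalues p = z ∧
      t = qSum hR.1.eigenvalues p / z := by
  obtain ⟨ht, hzt, heq⟩ := h
  have hz0 := ne_zero_of_im_pos hz
  have ht0 := ne_zero_of_im_pos ht
  have hzt0 := ne_zero_of_im_pos hzt
  have hc' : (c : ℂ) ≠ 0 := by exact_mod_cast hc.ne'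
  set κ := (z * c * t) / (1 - z * c ^ 2 * t ^ 2) with hκ
  have hinv : κ⁻¹ = (c * (z * t))⁻¹ - c * t := inv_coeff hc.ne' hz0 ht0
  have him : (κ⁻¹).im < 0 := by
    have h1 : ((c * (z * t))⁻¹).im < 0 := by
      rw [Complex.inv_im, Complex.im_ofReal_mul]
      exact div_neg_of_neg_of_pos (neg_neg_of_pos (mul_pos hc hzt))
        (Complex.normSq_pos.2 (mul_ne_zero hc' hzt0))
    rw [hinv, Complex.sub_im, Complex.im_ofReal_mul]
    nlinarith [mul_pos hc ht]
  -- A vanishing denominator would give `κ = 0` by the division convention; this is excluded because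
  -- `κ⁻¹` has negative imaginary part.
  have hκ0 : κ ≠ 0 := by
    intro h0
    rw [h0, inv_zero] at him
    simp at him
  have hκim : 0 < κ.im := by
    rw [Complex.inv_im, div_neg_iff] at him
    rcases him with ⟨-, h2⟩ | ⟨h1, -⟩
    · exact absurd h2 (not_lt.2 (Complex.normSq_nonneg _))
    · linarith
  set p := -z / κ with hp
  have hp0 : p ≠ 0 := div_ne_zero (neg_ne_zero.2 hz0) hκ0
  have hκp : κ = -z / p := by rw [hp]; field_simp
  have hne : ∀ i, -z - κ * (hR.1.eigenvalues i : ℂ) ≠ 0 := fun i h0 => by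
    have h1 := congrArg Complex.im h0
    rw [Complex.sub_im, Complex.neg_im, Complex.im_mul_ofReal, Complex.zero_im] at h1
    nlinarith [mul_pos hκim (hR.eigenvalues_pos i)]
  have hpi : ∀ i, (hR.1.eigenvalues i : ℂ) ≠ p := fun i h0 => by
    apply hne i
    rw [hκp, div_sub_eq hp0, h0]
    simp
  have htq : t = qSum hR.1.eigenvalues p / z := by
    rw [resolventMatrix_eq, ← hκ, trace_mul_inv_affine hR.1 hne, one_div, hκp,
      ← qSum_div_eq hpi hp0 hz0] at heq
    exact heq
  have hq : qSum hR.1.eigenvalues p = z * t := by rw [htq]; field_simp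
  have hphi : phi c hR.1.eigenvalues p = z := by
    have h1 : p = -z * ((c * (z * t))⁻¹ - c * t) := by rw [← hinv, hp, div_eq_mul_inv]
    rw [phi, hq, h1]
    field_simp
    ring
  refine ⟨p, mem_dom_of hc hz hphi (htq ▸ ht) (hq ▸ hzt.le), hphi, htq⟩

lemma existsUnique_isCanonicalSolution (hM : 0 < M) (hR : R.PosDef) (hc : 0 < c) (hc1 : c ≤ 1)
    (hz : 0 < z.im) : ∃! t : ℂ, IsCanonicalSolution c R z t := by
  have hr := hR.eigenvalues_pos
  have hm := pInv_mem hM hr hc hc1 hz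
  have hpz := phi_pInv hM hr hc hc1 hz
  refine ⟨_, (isCanonicalSolution_of_mem_dom hM hR hc hm hpz).1, fun t ht => ?_⟩
  obtain ⟨p, hp, hpz', rfl⟩ := exists_mem_dom_of_isCanonicalSolution hR hc hz ht
  rw [phi_injOn hM hr hc hp hm (hpz'.trans hpz.symm)]

lemma trace_matrixT (hM : 0 < M) (hR : R.PosDef) (hc : 0 < c) (hc1 : c ≤ 1) (hz : 0 < z.im) :
    (1 / (M : ℂ)) * (matrixT c R z).trace = mFun c hR.1.eigenvalues z := by
  have hr := hR.eigenvalues_pos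
  have h := isCanonicalSolution_of_mem_dom hM hR hc (pInv_mem hM hr hc hc1 hz)
    (phi_pInv hM hr hc hc1 hz)
  have hT : canonicalT c R z = qSum hR.1.eigenvalues (pInv c hR.1.eigenvalues z) / z :=
    (existsUnique_isCanonicalSolution hM hR hc hc1 hz).unique
      (Classical.epsilon_spec (p := IsCanonicalSolution c R z) ⟨_, h.1⟩) h.1
  rw [matrixT, hT, h.2, mFun_eq hM hr hc hc1 hz.le, pExt_eq hM hr hc hc1 hz]

lemma isProbabilityMeasure_bdryMeasure_mFun {r : Fin M → ℝ} (hM : 0 < M) (hr : ∀ i, 0 < r i)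
    (hc : 0 < c) (hc1 : c ≤ 1) : IsProbabilityMeasure (bdryMeasure (mFun c r)) := by
  obtain ⟨A, hA⟩ := exists_bound hM hr hc hc1
  exact isProbabilityMeasure_bdryMeasure (continuousOn_mFun hM hr hc hc1)
    (differentiableOn_mFun hM hr hc hc1) hA (fun x hx => im_mFun_of_neg hM hr hc hc1 hx)
    (fun x hx => im_mFun_nonneg hM hr hc hc1 hx) (tendsto_mFun_I hM hr hc hc1)

lemma hasCanonicalStieltjes_bdryMeasure (hM : 0 < M) (hR : R.PosDef) (hc : 0 < c) (hc1 : c ≤ 1) :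
    HasCanonicalStieltjes c R (bdryMeasure (mFun c hR.1.eigenvalues)) := by
  have hr := hR.eigenvalues_pos
  have hP := isProbabilityMeasure_bdryMeasure_mFun hM hr hc hc1
  obtain ⟨A, hA⟩ := exists_bound hM hr hc hc1
  refine ⟨inferInstance, ?_, fun z hz => ?_⟩
  · rw [bdryMeasure, withDensity_apply _ measurableSet_Iio, Measure.restrict_restrict
      measurableSet_Iio]
    have : Iio (0 : ℝ) ∩ Ioi 0 = ∅ := by
      ext x
      simp only [mem_inter_iff, mem_Iio, mem_Ioi, mem_empty_iff_false, iff_false, not_and, not_lt]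
      exact le_of_lt
    rw [this, Measure.restrict_empty, lintegral_zero_measure]
  · rw [trace_matrixT hM hR hc hc1 hz]
    exact stieltjes_bdryMeasure (continuousOn_mFun hM hr hc hc1)
      (differentiableOn_mFun hM hr hc hc1) hA (fun x hx => im_mFun_of_neg hM hr hc hc1 hx)
      (fun x hx => im_mFun_nonneg hM hr hc hc1 hx) hz

lemma HasCanonicalStieltjes_unique {μ ν : Measure ℝ} (hμ : HasCanonicalStieltjes c R μ)
    (hν : HasCanonicalStieltjes c R ν) : μ = ν := by
  have := hμ.finite
  have := hν.finite
  exact eq_of_stieltjes_eq fun z hz => (hμ.stieltjes z hz).trans (hν.stieltjes z hz).symm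

lemma isContinuousDensity_bdryMeasure {r : Fin M → ℝ} (hM : 0 < M) (hr : ∀ i, 0 < r i)
    (hc : 0 < c) (hc1 : c ≤ 1) :
    IsContinuousDensity (bdryMeasure (mFun c r)) (bdryDensity (mFun c r)) :=
  ⟨continuousOn_bdryDensity (continuousOn_mFun hM hr hc hc1),
    fun _ hx => div_nonneg (im_mFun_nonneg hM hr hc hc1 hx) Real.pi_pos.le, rfl⟩

end Canonical

end

theorem mainTheorem11 (M L N : ℕ) (hM : 0 < M) (hL : 0 < L) (hN : 0 < N)
    (R : Matrix (Fin M) (Fin M) ℂ) (hR : R.PosDef)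
    (c : ℝ) (hc : c = (M : ℝ) * (L : ℝ) / (N : ℝ)) (hc1 : c ≤ 1) :
    (∀ z : ℂ, 0 < z.im → ∃! t : ℂ, IsCanonicalSolution c R z t) ∧
    (∃! ν : Measure ℝ, HasCanonicalStieltjes c R ν) ∧
    HasCanonicalStieltjes c R (deterministicEquivalent c R) ∧
    IsProbabilityMeasure (deterministicEquivalent c R) ∧
    ∃ g : ℝ → ℝ, IsContinuousDensity (deterministicEquivalent c R) g ∧
      Tendsto g (𝓝[>] 0) atTop ∧
      (c < 1 → Asymptotics.IsEquivalent (𝓝[>] 0) g (fun x : ℝ =>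
        (1 / Real.pi) * (1 / Real.sqrt (c * (1 - c))) * normalizedTraceInv R
          * (1 / Real.sqrt x))) ∧
      (c = 1 → Asymptotics.IsEquivalent (𝓝[>] 0) g (fun x : ℝ =>
        (1 / Real.pi) * (Real.sqrt 3 / 2) * normalizedTraceInv R ^ (2 / 3 : ℝ)
          * (1 / x ^ (2 / 3 : ℝ)))) := by
  have hc0 : 0 < c := by rw [hc]; positivity
  clear hc
  have hr := hR.eigenvalues_pos
  have H := Canonical.hasCanonicalStieltjes_bdryMeasure hM hR hc0 hc1
  -- The chosen measure satisfies the defining property because the explicit one does, and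
  -- uniqueness identifies the two.
  have hE : deterministicEquivalent c R
      = Canonical.bdryMeasure (Canonical.mFun c hR.1.eigenvalues) :=
    Canonical.HasCanonicalStieltjes_unique
      (Classical.epsilon_spec (p := HasCanonicalStieltjes c R) ⟨_, H⟩) H
  rw [hE, Canonical.normalizedTraceInv_eq hR]
  refine ⟨fun z hz => Canonical.existsUnique_isCanonicalSolution hM hR hc0 hc1 hz,
    ⟨_, H, fun ν hν => Canonical.HasCanonicalStieltjes_unique hν H⟩, H,
    Canonical.isProbabilityMeasure_bdryMeasure_mFun hM hr hc0 hc1, _,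
    Canonical.isContinuousDensity_bdryMeasure hM hr hc0 hc1, ?_,
    fun h => (Canonical.density_of_lt hM hr hc0 h).1, ?_⟩
  · rcases hc1.lt_or_eq with h | rfl
    · exact (Canonical.density_of_lt hM hr hc0 h).2
    · exact (Canonical.density_of_eq_one hM hr).2
  · rintro rfl
    exact (Canonical.density_of_eq_one hM hr).1
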